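/- Let $\alpha>1$ and $\nu>0$. For $n\in\mathbb{N}$ put $R=R_n=2\log(n/\nu)$, and let $V$ be the set of points of a Poisson point process on the disk of points with polar coordinates $(r,\theta)$, $0\le r<R$, $0\le\theta<2\pi$, with intensity function $$g(r,\theta)=\nu e^{R/2}\cdot\frac{1}{2\pi}\cdot\frac{\alpha\sinh(\alpha r)}{\cosh(\alpha R)-1}$$ with respect to $dr\,d\theta$ (so that $\mathbb{E}|V|=n$ when $n>\nu$). Let $G=(V,E)$ be the graph in which two distinct points $u=(r_u,\theta_u)$ and $v=(r_v,\theta_v)$ of $V$ are joined by an edge if and only if their hyperbolic distance $d_h(u,v)\ge 0$, given by $$\cosh d_h(u,v)=\cosh r_u\cosh r_v-\sinh r_u\sinh r_v\cos(\theta_u-\theta_v),$$ is at most $R$; this is the Poissonized random hyperbolic graph $\mathrm{Poi}_{\alpha,\nu}(n)$. Let $|L_1|$ be the number of vertices of a largest connected component of $G$ (with $|L_1|=0$ if $V=\emptyset$). Then there is a constant $C>0$, depending only on $\alpha$ and $\nu$, such that the probability of the event $$n^{\frac{1}{2\alpha}}(\log n)^{-C}\le |L_1|\le n^{\frac{1}{2\alpha}}(\log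 n)^{C}$$ tends to $1$ as $n\to\infty$. -/

import Mathlib

open MeasureTheory ProbabilityTheory Filter Topology

noncomputable section

namespace HypGraph

/-- The number of points of the finite configuration `S` in the set `B`. -/
def count {E : Type*} (S : Finset E) (B : Set E) : ℕ := ((S : Set E) ∩ B).ncard

/-- The random finite set `V` is a (simple) Poisson point process with finite intensity measure
`μ`: counts on measurable sets are random variables, the count on `B` has the Poisson law with
parameter `μ B`, and counts on finitely many pairwise disjoint sets are independent. -/
structure IsPoissonProcess {Ω E : Type*} [MeasurableSpace Ω] [MeasurableSpace E]
    (V : Ω → Finset E) (μ : Measure E) [IsFiniteMeasure μ] (P : Measure Ω) : Prop where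
  measurable_count : ∀ B : Set E, MeasurableSet B → Measurable fun ω => count (V ω) B
  map_count : ∀ B : Set E, MeasurableSet B →
    P.map (fun ω => count (V ω) B) = poissonMeasure (μ B).toNNReal
  indep_count : ∀ (k : ℕ) (B : Fin k → Set E), (∀ i, MeasurableSet (B i)) →
    (Pairwise fun i j => Disjoint (B i) (B j)) →
    iIndepFun (fun i ω => count (V ω) (B i)) P

/-- The radius `R = 2 log (n / ν)` of the hyperbolic disk. -/
def radius (ν : ℝ) (n : ℕ) : ℝ := 2 * Real.log (n / ν)

/-- The density of the radial coordinate. -/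
def radialDensity (α R r : ℝ) : ℝ :=
  if 0 ≤ r ∧ r < R then α * Real.sinh (α * r) / (Real.cosh (α * R) - 1) else 0

/-- The joint density of the polar coordinates `(r, θ)`: `θ` is uniform on `[0, 2π)` and
independent of `r`. -/
def polarDensity (α R : ℝ) (p : ℝ × ℝ) : ℝ :=
  if 0 ≤ p.2 ∧ p.2 < 2 * Real.pi then radialDensity α R p.1 * (1 / (2 * Real.pi)) else 0

/-- The intensity function `ν e^{R/2} f(r, θ)`. -/
def intensityFun (α ν : ℝ) (n : ℕ) (p : ℝ × ℝ) : ℝ :=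
  ν * Real.exp (radius ν n / 2) * polarDensity α (radius ν n) p

/-- The intensity measure, in polar coordinates `(r, θ)`. -/
def intensity (α ν : ℝ) (n : ℕ) : Measure (ℝ × ℝ) :=
  volume.withDensity fun p => ENNReal.ofReal (intensityFun α ν n p)

/-- The hyperbolic distance of two points given in polar coordinates `(r, θ)`: the solution
`d ≥ 0` of the hyperbolic law of cosines. -/
def hypDist (u v : ℝ × ℝ) : ℝ :=
  Real.arcosh (Real.cosh u.1 * Real.cosh v.1
    - Real.sinh u.1 * Real.sinh v.1 * Real.cos (u.2 - v.2))

/-- The graph on the point set `S` joining distinct points at hyperbolic distance at most `R`. -/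
def graph (R : ℝ) (S : Finset (ℝ × ℝ)) : SimpleGraph S where
  Adj u v := u ≠ v ∧ hypDist u v ≤ R
  symm := ⟨fun u v h => ⟨h.1.symm, by
    have h2 := h.2
    unfold hypDist at h2 ⊢
    rw [← neg_sub (u : ℝ × ℝ).2, Real.cos_neg, mul_comm (Real.cosh (v : ℝ × ℝ).1),
      mul_comm (Real.sinh (v : ℝ × ℝ).1)]
    exact h2⟩⟩
  loopless := ⟨fun _ h => h.1 rfl⟩

/-- The number of vertices of a largest connected component (`0` for the empty graph). -/
def largestComponentSize {W : Type*} (G : SimpleGraph W) : ℕ :=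
  ⨆ c : G.ConnectedComponent, c.supp.ncard

instance (α ν : ℝ) (n : ℕ) : IsFiniteMeasure (intensity α ν n) := by
  set R := radius ν n
  have hcont : Continuous fun p : ℝ × ℝ => ν * Real.exp (R / 2) *
      ((α * Real.sinh (α * p.1) / (Real.cosh (α * R) - 1)) * (1 / (2 * Real.pi))) := by
    fun_prop
  have hK : IsCompact (Set.Icc (0 : ℝ) R ×ˢ Set.Icc (0 : ℝ) (2 * Real.pi)) :=
    isCompact_Icc.prod isCompact_Icc
  have hint := (hcont.continuousOn.integrableOn_compact (μ := volume) hK).norm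
  have hint2 := (integrable_indicator_iff hK.measurableSet).2 hint
  refine ⟨?_⟩
  rw [intensity, withDensity_apply _ MeasurableSet.univ, Measure.restrict_univ]
  refine lt_of_le_of_lt (lintegral_mono fun p => ENNReal.ofReal_le_ofReal ?_)
    hint2.lintegral_lt_top
  by_cases h : p ∈ Set.Icc (0 : ℝ) R ×ˢ Set.Icc (0 : ℝ) (2 * Real.pi)
  · rw [Set.indicator_of_mem h]
    simp only [intensityFun, polarDensity, radialDensity]
    split_ifs
    · exact le_abs_self _
    · rw [zero_mul, mul_zero]; exact norm_nonneg _
    · rw [mul_zero]; exact norm_nonneg _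
  · rw [Set.indicator_of_notMem h]
    simp only [intensityFun, polarDensity, radialDensity]
    split_ifs with h1 h2
    · exact absurd ⟨⟨h2.1, h2.2.le⟩, h1.1, h1.2.le⟩ h
    · simp
    · simp

/-- The vertex set of `Poi_{α,ν}(n)`: the random finite set `V` of points, in polar coordinates,
is a Poisson point process with the intensity above. -/
abbrev IsPoi {Ω : Type*} [MeasurableSpace Ω] (α ν : ℝ) (n : ℕ) (V : Ω → Finset (ℝ × ℝ))
    (P : Measure Ω) : Prop :=
  IsPoissonProcess V (intensity α ν n) P

end HypGraph

end

noncomputable section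

set_option linter.unusedSectionVars false

namespace HypGraph

/-! ### Inhomogeneous site percolation on a finite graph -/

section Percolation

variable {W : Type*}

/-- `Reach A T S u`: the vertex `u` is reachable from `S ∩ T` along `A`-steps inside `T`. -/
inductive Reach (A : W → W → Prop) (T S : Set W) : W → Prop
  | base {s : W} : s ∈ S → s ∈ T → Reach A T S s
  | step {u x : W} : Reach A T S u → A u x → x ∈ T → Reach A T S x

lemma Reach.eq_or_explore {A : W → W → Prop} {T S : Set W} {u : W} (h : Reach A T S u) (v : W) :
    u = v ∨ Reach A (T \ {v}) (S \ {v} ∪ {x | A v x}) u := by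
  induction h with
  | @base s hs hT =>
    by_cases hv : s = v
    · exact Or.inl hv
    · exact Or.inr (.base (Or.inl ⟨hs, hv⟩) ⟨hT, hv⟩)
  | @step u x hu hA hT ih =>
    by_cases hv : x = v
    · exact Or.inl hv
    · right
      rcases ih with rfl | ih
      · exact .base (Or.inr hA) ⟨hT, hv⟩
      · exact .step ih hA ⟨hT, hv⟩

lemma Reach.of_notMem {A : W → W → Prop} {T S : Set W} {u v : W} (h : Reach A T S u)
    (hv : v ∉ T) : Reach A T (S \ {v}) u := by
  induction h with
  | base hs hT => exact .base ⟨hs, fun h => hv (h ▸ hT)⟩ hT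
  | step _ hA hT ih => exact .step ih hA hT

variable [Fintype W] [DecidableEq W]

open Classical in
/-- The set of vertices of `T` reachable from `S` inside `T`. -/
def cluster (A : W → W → Prop) (T S : Finset W) : Finset W :=
  Finset.univ.filter fun u => Reach A (T : Set W) (S : Set W) u

lemma mem_cluster {A : W → W → Prop} {T S : Finset W} {u : W} :
    u ∈ cluster A T S ↔ Reach A (T : Set W) (S : Set W) u := by
  simp [cluster]

/-- The expectation of `f T` for a random subset `T` of `U` containing each `u ∈ U`
independently with probability `p u`. -/
def siteExp (p : W → ℝ) (U : Finset W) (f : Finset W → ℝ) : ℝ :=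
  ∑ T ∈ U.powerset, (∏ u ∈ T, p u) * (∏ u ∈ U \ T, (1 - p u)) * f T

lemma siteExp_one (p : W → ℝ) (U : Finset W) : siteExp p U (fun _ => 1) = 1 := by
  simp only [siteExp, mul_one]
  rw [← Finset.prod_add]
  simp

lemma siteExp_insert (p : W → ℝ) {U : Finset W} {v : W} (hv : v ∉ U) (f : Finset W → ℝ) :
    siteExp p (insert v U) f =
      (1 - p v) * siteExp p U f + p v * siteExp p U (fun T => f (insert v T)) := by
  rw [siteExp, Finset.sum_powerset_insert hv, siteExp, siteExp, Finset.mul_sum, Finset.mul_sum]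
  congr 1 <;> refine Finset.sum_congr rfl fun T hT => ?_
  · have hvT : v ∉ T := fun h => hv (Finset.mem_powerset.1 hT h)
    rw [Finset.insert_sdiff_of_notMem _ hvT, Finset.prod_insert (by simp [hv])]
    ring
  · have hvT : v ∉ T := fun h => hv (Finset.mem_powerset.1 hT h)
    rw [Finset.prod_insert hvT, Finset.insert_sdiff_insert, Finset.sdiff_insert_of_notMem hv]
    ring

lemma siteExp_mono {p : W → ℝ} (hp0 : ∀ u, 0 ≤ p u) (hp1 : ∀ u, p u ≤ 1) {U : Finset W}
    {f g : Finset W → ℝ} (h : ∀ T ⊆ U, f T ≤ g T) : siteExp p U f ≤ siteExp p U g := by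
  refine Finset.sum_le_sum fun T hT => mul_le_mul_of_nonneg_left (h T (Finset.mem_powerset.1 hT)) ?_
  exact mul_nonneg (Finset.prod_nonneg fun u _ => hp0 u)
    (Finset.prod_nonneg fun u _ => sub_nonneg.2 (hp1 u))

lemma siteExp_const_mul (p : W → ℝ) (U : Finset W) (c : ℝ) (f : Finset W → ℝ) :
    siteExp p U (fun T => c * f T) = c * siteExp p U f := by
  rw [siteExp, siteExp, Finset.mul_sum]
  exact Finset.sum_congr rfl fun T _ => by ring

open Classical in
/-- Exponential moments of the weight of the cluster of `S`. -/
theorem siteExp_cluster_le {A : W → W → Prop} {p w g : W → ℝ} (hp0 : ∀ u, 0 ≤ p u)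
    (hp1 : ∀ u, p u ≤ 1) (hw : ∀ u, 0 ≤ w u) (hg : ∀ u, 0 ≤ g u)
    (h : ∀ v, w v + ∑ u with A v u, p u * (Real.exp (g u) - 1) ≤ g v) (U : Finset W) :
    ∀ S : Finset W, siteExp p U (fun T => Real.exp (∑ u ∈ cluster A T S, w u)) ≤
      ∏ s ∈ S, (1 + p s * (Real.exp (g s) - 1)) := by
  have hf : ∀ u, 0 ≤ p u * (Real.exp (g u) - 1) := fun u =>
    mul_nonneg (hp0 u) (sub_nonneg.2 (Real.one_le_exp (hg u)))
  have hf1 : ∀ u, 1 ≤ 1 + p u * (Real.exp (g u) - 1) := fun u => by linarith [hf u]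
  induction U using Finset.strongInduction with
  | H U ih =>
  intro S
  by_cases hSU : ∃ v ∈ S, v ∈ U
  · obtain ⟨v, hvS, hvU⟩ := hSU
    obtain ⟨U', hvU', rfl⟩ : ∃ U', v ∉ U' ∧ insert v U' = U :=
      ⟨U.erase v, by simp, Finset.insert_erase hvU⟩
    rw [siteExp_insert p hvU']
    have hlt : U' ⊂ insert v U' := Finset.ssubset_insert hvU'
    set N : Finset W := Finset.univ.filter fun u => A v u with hN
    have h1 : siteExp p U' (fun T => Real.exp (∑ u ∈ cluster A T S, w u)) ≤
        ∏ s ∈ S.erase v, (1 + p s * (Real.exp (g s) - 1)) := by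
      refine (siteExp_mono hp0 hp1 fun T hT => ?_).trans (ih U' hlt (S.erase v))
      refine Real.exp_le_exp.2 (Finset.sum_le_sum_of_subset_of_nonneg (fun u hu => ?_)
        fun u _ _ => hw u)
      rw [mem_cluster] at hu ⊢
      have := hu.of_notMem (v := v) (fun h => hvU' (hT h))
      simpa using this
    have h2 : siteExp p U' (fun T => Real.exp (∑ u ∈ cluster A (insert v T) S, w u)) ≤
        Real.exp (w v) * ∏ s ∈ S.erase v ∪ N, (1 + p s * (Real.exp (g s) - 1)) := by
      have := mul_le_mul_of_nonneg_left (ih U' hlt (S.erase v ∪ N)) (Real.exp_pos (w v)).le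
      rw [← siteExp_const_mul] at this
      refine (siteExp_mono hp0 hp1 fun T hT => ?_).trans this
      rw [← Real.exp_add]
      refine Real.exp_le_exp.2 ?_
      have hsub : cluster A (insert v T) S ⊆ insert v (cluster A T (S.erase v ∪ N)) := by
        intro u hu
        rw [mem_cluster] at hu
        rw [Finset.mem_insert, mem_cluster]
        refine (hu.eq_or_explore v).imp id fun h' => ?_
        have hTv : (((insert v T : Finset W) : Set W) \ {v}) = (T : Set W) := by
          have : v ∉ T := fun h => hvU' (hT h)
          simp [this]
        rw [hTv] at h'
        simpa [hN] using h'
      refine (Finset.sum_le_sum_of_subset_of_nonneg hsub fun u _ _ => hw u).trans ?_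
      by_cases hv : v ∈ cluster A T (S.erase v ∪ N)
      · rw [Finset.insert_eq_of_mem hv]; linarith [hw v]
      · rw [Finset.sum_insert hv]
    have h3 : ∏ s ∈ S.erase v ∪ N, (1 + p s * (Real.exp (g s) - 1)) ≤
        (∏ s ∈ S.erase v, (1 + p s * (Real.exp (g s) - 1))) * Real.exp (g v - w v) := by
      have hle : ∏ s ∈ N, (1 + p s * (Real.exp (g s) - 1)) ≤ Real.exp (g v - w v) := by
        refine le_trans (Finset.prod_le_prod (fun u _ => by linarith [hf1 u]) fun u _ =>
          (by linarith [Real.add_one_le_exp (p u * (Real.exp (g u) - 1))] :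
            _ ≤ Real.exp (p u * (Real.exp (g u) - 1)))) ?_
        rw [← Real.exp_sum]
        exact Real.exp_le_exp.2 (by linarith [h v])
      have hP : 0 ≤ ∏ s ∈ S.erase v, (1 + p s * (Real.exp (g s) - 1)) :=
        Finset.prod_nonneg fun u _ => by linarith [hf1 u]
      refine le_trans ?_ (mul_le_mul_of_nonneg_left hle hP)
      rw [← Finset.prod_union_inter]
      refine le_mul_of_one_le_right (Finset.prod_nonneg fun u _ => by linarith [hf1 u]) ?_
      exact Finset.one_le_prod fun u _ => hf1 u
    have hP : 0 ≤ ∏ s ∈ S.erase v, (1 + p s * (Real.exp (g s) - 1)) :=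
      Finset.prod_nonneg fun u _ => by linarith [hf1 u]
    have h4 : Real.exp (w v) * Real.exp (g v - w v) = Real.exp (g v) := by
      rw [← Real.exp_add]; congr 1; ring
    rw [← Finset.mul_prod_erase S _ hvS]
    calc _ ≤ (1 - p v) * ∏ s ∈ S.erase v, (1 + p s * (Real.exp (g s) - 1)) +
          p v * (Real.exp (w v) *
            ((∏ s ∈ S.erase v, (1 + p s * (Real.exp (g s) - 1))) * Real.exp (g v - w v))) :=
          add_le_add (mul_le_mul_of_nonneg_left h1 (sub_nonneg.2 (hp1 v)))
            (mul_le_mul_of_nonneg_left (h2.trans (mul_le_mul_of_nonneg_left h3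
              (Real.exp_pos _).le)) (hp0 v))
      _ = _ := by rw [← h4]; ring
  · push Not at hSU
    have : siteExp p U (fun T => Real.exp (∑ u ∈ cluster A T S, w u)) ≤
        siteExp p U (fun _ => 1) := by
      refine siteExp_mono hp0 hp1 fun T hT => ?_
      have : cluster A T S = ∅ := by
        refine Finset.eq_empty_of_forall_notMem fun u hu => ?_
        rw [mem_cluster] at hu
        induction hu with
        | base hs hT' => exact hSU _ hs (hT hT')
        | step _ _ _ ih => exact ih
      simp [this]
    rw [siteExp_one] at this
    exact this.trans (Finset.one_le_prod fun u _ => hf1 u)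

open Classical in
/-- Exponential tail of the weight of the cluster of `S` in the random set `{v | X v ≠ 0}`. -/
theorem measure_cluster_le {Ω : Type*} [MeasurableSpace Ω] {P : Measure Ω}
    [IsProbabilityMeasure P] {X : W → Ω → ℕ} (hX : ∀ v, Measurable (X v)) (hind : iIndepFun X P)
    {A : W → W → Prop} {w g : W → ℝ} (hw : ∀ u, 0 ≤ w u) (hg : ∀ u, 0 ≤ g u)
    (h : ∀ v, w v + ∑ u with A v u, P.real {ω | X u ω ≠ 0} * (Real.exp (g u) - 1) ≤ g v)
    (S : Finset W) (x : ℝ) :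
    P.real {ω | x ≤ ∑ u ∈ cluster A (Finset.univ.filter fun v => X v ω ≠ 0) S, w u} ≤
      Real.exp (-x) * ∏ s ∈ S, (1 + P.real {ω | X s ω ≠ 0} * (Real.exp (g s) - 1)) := by
  set p : W → ℝ := fun v => P.real {ω | X v ω ≠ 0} with hp
  have hprob : ∀ T : Finset W, P.real {ω | (Finset.univ.filter fun v => X v ω ≠ 0) = T} =
      (∏ u ∈ T, p u) * ∏ u ∈ Finset.univ \ T, (1 - p u) := by
    intro T
    have hset : {ω | (Finset.univ.filter fun v => X v ω ≠ 0) = T} =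
        ⋂ v ∈ (Finset.univ : Finset W), X v ⁻¹' (if v ∈ T then {0}ᶜ else {0}) := by
      ext ω
      simp only [Set.mem_ofPred_eq, Set.mem_iInter, Finset.ext_iff, Finset.mem_filter,
        Finset.mem_univ, true_and, forall_const]
      refine forall_congr' fun v => ?_
      by_cases hv : v ∈ T <;> simp [hv]
    rw [hset, measureReal_def, hind.measure_inter_preimage_eq_mul Finset.univ
      (fun v _ => MeasurableSet.of_discrete), ENNReal.toReal_prod,
      ← Finset.prod_sdiff (Finset.subset_univ T), mul_comm]
    congr 1
    · refine Finset.prod_congr rfl fun v hv => ?_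
      simp only [hv, if_true]
      rfl
    · refine Finset.prod_congr rfl fun v hv => ?_
      have hv' : v ∉ T := (Finset.mem_sdiff.1 hv).2
      have : X v ⁻¹' {0} = {ω | X v ω ≠ 0}ᶜ := by ext; simp
      simp only [hv', if_false, hp]
      have hm : MeasurableSet {ω | X v ω ≠ 0} := (hX v) (MeasurableSet.of_discrete (s := {0}ᶜ))
      rw [this, ← measureReal_def]
      exact probReal_compl_eq_one_sub hm
  have hp0 : ∀ u, 0 ≤ p u := fun u => measureReal_nonneg
  have hp1 : ∀ u, p u ≤ 1 := fun u => measureReal_le_one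
  refine le_trans ?_ (mul_le_mul_of_nonneg_left
    (siteExp_cluster_le hp0 hp1 hw hg h Finset.univ S) (Real.exp_pos _).le)
  have hcover : {ω | x ≤ ∑ u ∈ cluster A (Finset.univ.filter fun v => X v ω ≠ 0) S, w u} ⊆
      ⋃ T ∈ (Finset.univ : Finset (Finset W)).filter fun T => x ≤ ∑ u ∈ cluster A T S, w u,
        {ω | (Finset.univ.filter fun v => X v ω ≠ 0) = T} := by
    intro ω hω
    simp only [Set.mem_iUnion, Finset.mem_filter, Finset.mem_univ, true_and]
    exact ⟨_, hω, rfl⟩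
  refine (measureReal_mono hcover (measure_ne_top _ _)).trans ((measureReal_biUnion_finset_le _ _).trans ?_)
  rw [siteExp, Finset.powerset_univ, Finset.mul_sum]
  have hn : ∀ T : Finset W, 0 ≤ (∏ u ∈ T, p u) * ∏ u ∈ Finset.univ \ T, (1 - p u) := fun T =>
    mul_nonneg (Finset.prod_nonneg fun u _ => hp0 u)
      (Finset.prod_nonneg fun u _ => sub_nonneg.2 (hp1 u))
  refine (Finset.sum_le_sum (g := fun T => Real.exp (-x) * ((∏ u ∈ T, p u) *
      (∏ u ∈ Finset.univ \ T, (1 - p u)) * Real.exp (∑ u ∈ cluster A T S, w u))) fun T hT => ?_).trans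
    (Finset.sum_le_sum_of_subset_of_nonneg (Finset.subset_univ _) fun T _ _ =>
      mul_nonneg (Real.exp_pos _).le (mul_nonneg (hn T) (Real.exp_pos _).le))
  rw [hprob, mul_left_comm, ← Real.exp_add]
  refine le_mul_of_one_le_right (hn T) (Real.one_le_exp ?_)
  linarith [(Finset.mem_filter.1 hT).2]

end Percolation

/-! ### Layered graphs on a circle of length `N` -/

section Layered

/-- The points `x` and `y` of the circle `ℝ / Nℤ` are at distance at most `D`. -/
def near (N : ℕ) (D x y : ℝ) : Prop := ∃ k : ℤ, |x - y + k * N| ≤ D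

lemma near.symm {N : ℕ} {D x y : ℝ} (h : near N D x y) : near N D y x := by
  obtain ⟨k, hk⟩ := h
  refine ⟨-k, ?_⟩
  rwa [show y - x + ((-k : ℤ) : ℝ) * N = -(x - y + k * N) by push_cast; ring, abs_neg]

lemma near.mono {N : ℕ} {D D' x y : ℝ} (h : near N D x y) (hD : D ≤ D') : near N D' x y :=
  h.imp fun _ hk => hk.trans hD

lemma near.trans {N : ℕ} {D D' x y z : ℝ} (h : near N D x y) (h' : near N D' y z) :
    near N (D + D') x z := by
  obtain ⟨k, hk⟩ := h
  obtain ⟨l, hl⟩ := h'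
  refine ⟨k + l, ?_⟩
  have := (abs_add_le (x - y + k * N) (y - z + l * N)).trans (add_le_add hk hl)
  rwa [show x - y + k * N + (y - z + l * N) = x - z + ((k + l : ℤ) : ℝ) * N by
    push_cast; ring] at this

lemma near_of_abs_sub_le {N : ℕ} {D x y : ℝ} (h : |x - y| ≤ D) : near N D x y :=
  ⟨0, by simpa using h⟩

lemma card_Icc_ceil_floor_le {a b : ℝ} (hab : a ≤ b + 1) :
    ((Finset.Icc ⌈a⌉ ⌊b⌋).card : ℝ) ≤ b - a + 1 := by
  rw [Int.card_Icc]
  have h1 := Int.le_ceil a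
  have h2 := Int.floor_le b
  rcases le_total 0 (⌊b⌋ + 1 - ⌈a⌉) with h | h
  · have : (((⌊b⌋ + 1 - ⌈a⌉).toNat : ℤ) : ℝ) = ((⌊b⌋ + 1 - ⌈a⌉ : ℤ) : ℝ) := by
      rw [Int.toNat_of_nonneg h]
    rw [← Int.cast_natCast, this]
    push_cast
    linarith
  · rw [Int.toNat_of_nonpos h]
    simp; linarith

open Classical in
lemma card_near_le {V : Type*} [Fintype V] {N m : ℕ} (ξ : V → ℝ) (hξ0 : ∀ v, 0 ≤ ξ v)
    (hξN : ∀ v, ξ v < N)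
    (hm : ∀ i : ℕ, i < N → (Finset.univ.filter fun v => ⌊ξ v⌋₊ = i).card ≤ m) {D : ℝ} (hD : 0 ≤ D)
    (x : ℝ) : ((Finset.univ.filter fun v => near N D x (ξ v)).card : ℝ) ≤ (2 * D + 2) * m := by
  rcases Nat.eq_zero_or_pos N with rfl | hN
  · have : IsEmpty V := ⟨fun v => by
      have h1 := hξ0 v
      have h2 := hξN v
      simp only [Nat.cast_zero] at h2
      linarith⟩
    simp only [Finset.univ_eq_empty, Finset.filter_empty, Finset.card_empty, Nat.cast_zero]
    positivity
  have hNz : (0 : ℤ) < N := by exact_mod_cast hN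
  have hsub : (Finset.univ.filter fun v => near N D x (ξ v)) ⊆
      (Finset.Icc ⌈x - D - 1⌉ ⌊x + D⌋).biUnion fun z =>
        Finset.univ.filter fun v => ⌊ξ v⌋₊ = (z % N).toNat := by
    intro v hv
    obtain ⟨k, hk⟩ := (Finset.mem_filter.1 hv).2
    rw [abs_le] at hk
    have hfl : ((⌊ξ v⌋₊ : ℤ) : ℝ) = (⌊ξ v⌋₊ : ℝ) := by push_cast; rfl
    have h1 := Nat.floor_le (hξ0 v)
    have h2 := Nat.lt_floor_add_one (ξ v)
    rw [Finset.mem_biUnion]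
    refine ⟨(⌊ξ v⌋₊ : ℤ) - k * N, ?_, ?_⟩
    · rw [Finset.mem_Icc, Int.ceil_le, Int.le_floor]
      push_cast
      constructor <;> linarith [hk.1, hk.2]
    · rw [Finset.mem_filter]
      refine ⟨Finset.mem_univ _, ?_⟩
      have hlt : (⌊ξ v⌋₊ : ℤ) < N := by
        have : (⌊ξ v⌋₊ : ℝ) < N := h1.trans_lt (hξN v)
        exact_mod_cast this
      rw [sub_eq_add_neg, ← neg_mul, Int.add_mul_emod_self_right,
        Int.emod_eq_of_lt (by positivity) hlt]
      simp
  have hcard := (Finset.card_le_card hsub).trans (Finset.card_biUnion_le_card_mul _ _ m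
    fun z _ => hm _ (by have := Int.emod_lt_of_pos z hNz; have := Int.emod_nonneg z hNz.ne'; omega))
  calc ((Finset.univ.filter fun v => near N D x (ξ v)).card : ℝ)
      ≤ ((Finset.Icc ⌈x - D - 1⌉ ⌊x + D⌋).card : ℝ) * m := by exact_mod_cast hcard
    _ ≤ (2 * D + 2) * m := by
      refine mul_le_mul_of_nonneg_right ?_ (Nat.cast_nonneg m)
      have := card_Icc_ceil_floor_le (a := x - D - 1) (b := x + D) (by linarith)
      linarith

variable {V : Type*} {G : SimpleGraph V} {ξ : V → ℝ} {lay : V → ℕ} {N : ℕ} {c q : ℝ}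

/-- No point of a layer below `J₁` is within `c q ^ (2 j)` of `y`, where `j` is its layer. -/
def IsGap (ξ : V → ℝ) (lay : V → ℕ) (N J₁ : ℕ) (c q y : ℝ) : Prop :=
  ∀ v, lay v < J₁ → ∀ k : ℤ, c * q ^ (2 * lay v) ≤ |ξ v + k * N - y|

lemma two_mul_pow_add_le (q : ℝ) (i j : ℕ) : 2 * q ^ (i + j) ≤ q ^ (2 * i) + q ^ (2 * j) := by
  have := sq_nonneg (q ^ i - q ^ j)
  rw [pow_add, two_mul i, two_mul j, pow_add, pow_add]
  nlinarith

/-- Two low points of `G`, joined by an edge. -/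
def LowAdj (G : SimpleGraph V) (lay : V → ℕ) (J₁ : ℕ) (u v : V) : Prop :=
  G.Adj u v ∧ lay u < J₁ ∧ lay v < J₁

lemma LowAdj.not_cross (hc : 0 < c) (hq : 0 < q) {J₁ : ℕ}
    (hadj : ∀ u v, G.Adj u v → near N (c * q ^ (lay u + lay v)) (ξ u) (ξ v)) {u v : V}
    (h : LowAdj G lay J₁ u v) {y₁ y₂ : ℝ} (h1 : IsGap ξ lay N J₁ c q y₁)
    (h2 : IsGap ξ lay N J₁ c q y₂) (hu : ∃ k : ℤ, y₁ < ξ u + k * N ∧ ξ u + k * N < y₂) :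
    ∃ k : ℤ, y₁ < ξ v + k * N ∧ ξ v + k * N < y₂ := by
  obtain ⟨k, hk1, hk2⟩ := hu
  obtain ⟨l, hl⟩ := hadj u v h.1
  have hp := two_mul_pow_add_le q (lay u) (lay v)
  have hpos : 0 < c * q ^ (lay u + lay v) := by positivity
  have hp' : 2 * (c * q ^ (lay u + lay v)) ≤ c * q ^ (2 * lay u) + c * q ^ (2 * lay v) := by
    nlinarith
  rw [abs_le] at hl
  refine ⟨k - l, ?_, ?_⟩
  · by_contra hcon
    push Not at hcon
    have a1 := h1 u h.2.1 k
    have a2 := h1 v h.2.2 (k - l)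
    rw [abs_of_pos (by linarith)] at a1
    rw [abs_of_nonpos (by linarith)] at a2
    push_cast at *
    linarith [hl.1, hl.2]
  · by_contra hcon
    push Not at hcon
    have a1 := h2 u h.2.1 k
    have a2 := h2 v h.2.2 (k - l)
    rw [abs_of_neg (by linarith)] at a1
    rw [abs_of_nonneg (by linarith)] at a2
    push_cast at *
    linarith [hl.1, hl.2]

lemma near_of_lowAdj_reflTransGen (hc : 0 < c) (hq : 0 < q) {J₁ : ℕ}
    (hadj : ∀ u v, G.Adj u v → near N (c * q ^ (lay u + lay v)) (ξ u) (ξ v)) {w : ℝ}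
    (hgap : ∀ x : ℝ, ∃ y, x ≤ y ∧ y ≤ x + w ∧ IsGap ξ lay N J₁ c q y) {u v : V}
    (hu : lay u < J₁) (h : Relation.ReflTransGen (LowAdj G lay J₁) u v) :
    near N w (ξ u) (ξ v) := by
  obtain ⟨y₁, h11, h12, h1⟩ := hgap (ξ u - w)
  obtain ⟨y₂, h21, h22, h2⟩ := hgap (ξ u)
  have hpos : 0 < c * q ^ (2 * lay u) := by positivity
  have a1 := h1 u hu 0
  have a2 := h2 u hu 0
  simp only [Int.cast_zero, zero_mul, add_zero] at a1 a2
  have key : ∃ k : ℤ, y₁ < ξ v + k * N ∧ ξ v + k * N < y₂ := by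
    induction h with
    | refl =>
      refine ⟨0, ?_, ?_⟩
      · rw [abs_of_nonneg (by linarith)] at a1
        simp; linarith
      · rw [abs_of_nonpos (by linarith)] at a2
        simp; linarith
    | tail _ h' ih => exact h'.not_cross hc hq hadj h1 h2 ih
  obtain ⟨k, hk1, hk2⟩ := key
  refine ⟨-k, ?_⟩
  rw [abs_le]
  push_cast
  constructor <;> linarith

/-- Adjacency of the sites (unit cell, layer). -/
def siteAdj (N J J₁ : ℕ) (K q : ℝ) (s t : Fin N × Fin J) : Prop :=
  J₁ ≤ (t.2 : ℕ) ∧ near N (K * q ^ ((s.2 : ℕ) + (t.2 : ℕ))) (s.1 : ℕ) (t.1 : ℕ)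

open Classical in
/-- A bound for the sizes of the components of a layered graph, in terms of the width of the low
clusters, the occupation of the cells and the weights of the clusters of sites. -/
theorem ncard_supp_le [Fintype V] (hc : 0 < c) (hq : 1 ≤ q) {J J₁ m : ℕ}
    (hξ0 : ∀ v, 0 ≤ ξ v) (hξN : ∀ v, ξ v < N) (hJ : ∀ v, lay v < J)
    (hadj : ∀ u v, G.Adj u v → near N (c * q ^ (lay u + lay v)) (ξ u) (ξ v))
    {w ω : ℝ} (hw : 0 ≤ w)
    (hω : 0 ≤ ω) (hwω : w ≤ ω * q ^ (2 * J₁))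
    (hgap : ∀ x : ℝ, ∃ y, x ≤ y ∧ y ≤ x + w ∧ IsGap ξ lay N J₁ c q y)
    (hm : ∀ i : ℕ, i < N → (Finset.univ.filter fun v => ⌊ξ v⌋₊ = i).card ≤ m)
    (T : Finset (Fin N × Fin J))
    (hT : ∀ v, ∀ s : Fin N × Fin J, (s.1 : ℕ) = ⌊ξ v⌋₊ → (s.2 : ℕ) = lay v → s ∈ T) {B : ℝ}
    (hB1 : 1 ≤ B)
    (hB : ∀ s, ∑ t ∈ cluster (siteAdj N J J₁ (2 * c + ω + 1) q) T {s}, q ^ (t.2 : ℕ) ≤ B)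
    (C : G.ConnectedComponent) :
    (C.supp.ncard : ℝ) ≤ m * ((2 * c * q ^ J₁ + 2 * w + 4) * B) := by
  have hq0 : 0 < q := by linarith
  have hqJ : 0 < q ^ J₁ := by positivity
  by_cases hhigh : ∃ v₀ ∈ C.supp, J₁ ≤ lay v₀
  · obtain ⟨v₀, hv₀, hh₀⟩ := hhigh
    have hfl : ∀ v, ⌊ξ v⌋₊ < N := fun v => (Nat.floor_lt (hξ0 v)).2 (hξN v)
    set site : V → Fin N × Fin J := fun v => (⟨⌊ξ v⌋₊, hfl v⟩, ⟨lay v, hJ v⟩) with hsite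
    have hsT : ∀ v, site v ∈ T := fun v => hT v _ rfl rfl
    set A := siteAdj N J J₁ (2 * c + ω + 1) q with hA
    have hfloor : ∀ v, |((⌊ξ v⌋₊ : ℕ) : ℝ) - ξ v| ≤ 1 := fun v => by
      have h1 := Nat.floor_le (hξ0 v)
      have h2 := Nat.lt_floor_add_one (ξ v)
      rw [abs_le]; constructor <;> linarith
    have hsA : ∀ u v : V, J₁ ≤ lay v → near N ((2 * c + ω) * q ^ (lay u + lay v)) (ξ u) (ξ v) →
        A (site u) (site v) := by
      intro u v hv h
      refine ⟨hv, ?_⟩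
      obtain ⟨k, hk⟩ := h
      refine ⟨k + 0, ?_⟩
      have h1 := Nat.floor_le (hξ0 u)
      have h2 := Nat.lt_floor_add_one (ξ u)
      have h3 := Nat.floor_le (hξ0 v)
      have h4 := Nat.lt_floor_add_one (ξ v)
      have h5 : (1 : ℝ) ≤ q ^ (lay u + lay v) := one_le_pow₀ hq
      rw [abs_le] at hk ⊢
      simp only [hsite, add_zero]
      constructor <;> nlinarith [hk.1, hk.2]
    have key : ∀ u, G.Reachable v₀ u → ∃ v, J₁ ≤ lay v ∧
        Reach A (T : Set (Fin N × Fin J)) {site v₀} (site v) ∧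
        (u = v ∨ ∃ u₁, lay u₁ < J₁ ∧ G.Adj v u₁ ∧
          Relation.ReflTransGen (LowAdj G lay J₁) u₁ u ∧ lay u < J₁) := by
      intro u hu
      rw [SimpleGraph.reachable_iff_reflTransGen] at hu
      induction hu with
      | refl => exact ⟨v₀, hh₀, .base rfl (hsT v₀), Or.inl rfl⟩
      | @tail u u' _ huu' ih =>
        obtain ⟨v, hv, hR, h | ⟨u₁, hu₁, hvu₁, hlow, hu⟩⟩ := ih
        · subst h
          by_cases hu' : J₁ ≤ lay u'
          · refine ⟨u', hu', .step hR (hsA u u' hu' ((hadj u u' huu').mono ?_)) (hsT u'),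
              Or.inl rfl⟩
            gcongr
            linarith
          · push Not at hu'
            exact ⟨u, hv, hR, Or.inr ⟨u', hu', huu', .refl, hu'⟩⟩
        · by_cases hu' : J₁ ≤ lay u'
          · refine ⟨u', hu', .step hR (hsA v u' hu' ?_) (hsT u'), Or.inl rfl⟩
            refine (((hadj v u₁ hvu₁).trans (near_of_lowAdj_reflTransGen hc hq0 hadj hgap hu₁
              hlow)).trans (hadj u u' huu')).mono ?_
            have e1 : q ^ (lay v + lay u₁) ≤ q ^ (lay v + lay u') :=
              pow_le_pow_right₀ hq (by omega)
            have e2 : q ^ (lay u + lay u') ≤ q ^ (lay v + lay u') :=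
              pow_le_pow_right₀ hq (by omega)
            have e3 : q ^ (2 * J₁) ≤ q ^ (lay v + lay u') :=
              pow_le_pow_right₀ hq (by omega)
            nlinarith
          · push Not at hu'
            exact ⟨v, hv, hR, Or.inr ⟨u₁, hu₁, hvu₁, hlow.tail ⟨huu', hu, hu'⟩, hu'⟩⟩
    set Dw : ℕ → ℝ := fun j => c * q ^ (j + J₁) + w + 1 with hDw
    have hsub : C.supp ⊆ ((cluster A T {site v₀}).biUnion fun s =>
        Finset.univ.filter fun u => near N (Dw (s.2 : ℕ)) (s.1 : ℕ) (ξ u) : Finset V) := by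
      intro u hu
      have hr : G.Reachable v₀ u := by
        rw [← SimpleGraph.ConnectedComponent.eq]
        exact (SimpleGraph.ConnectedComponent.mem_supp_iff _ _ |>.1 hv₀).trans
          (SimpleGraph.ConnectedComponent.mem_supp_iff _ _ |>.1 hu).symm
      obtain ⟨v, hv, hR, h⟩ := key u hr
      rw [Finset.mem_coe, Finset.mem_biUnion]
      refine ⟨site v, by rw [mem_cluster]; simpa using hR, ?_⟩
      rw [Finset.mem_filter]
      refine ⟨Finset.mem_univ _, ?_⟩
      have hself : near N 1 ((⌊ξ v⌋₊ : ℕ) : ℝ) (ξ v) := near_of_abs_sub_le (hfloor v)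
      rcases h with rfl | ⟨u₁, hu₁, hvu₁, hlow, hu⟩
      · refine hself.mono ?_
        have : 0 ≤ c * q ^ (lay u + J₁) := by positivity
        simp only [hDw, hsite]
        linarith
      · refine ((hself.trans (hadj v u₁ hvu₁)).trans
          (near_of_lowAdj_reflTransGen hc hq0 hadj hgap hu₁ hlow)).mono ?_
        have e1 : q ^ (lay v + lay u₁) ≤ q ^ (lay v + J₁) := pow_le_pow_right₀ hq (by omega)
        simp only [hDw, hsite]
        nlinarith
    have hcard := Set.ncard_le_ncard hsub (Finset.finite_toSet _)
    rw [Set.ncard_coe_finset] at hcard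
    have hD : ∀ j, 2 * Dw j + 2 ≤ (2 * c * q ^ J₁ + 2 * w + 4) * q ^ j := by
      intro j
      have e3 : 1 ≤ q ^ j := one_le_pow₀ hq
      simp only [hDw, pow_add]
      nlinarith
    calc (C.supp.ncard : ℝ) ≤ ∑ s ∈ cluster A T {site v₀},
          ((Finset.univ.filter fun u => near N (Dw (s.2 : ℕ)) (s.1 : ℕ) (ξ u)).card : ℝ) := by
          exact_mod_cast hcard.trans Finset.card_biUnion_le
      _ ≤ ∑ s ∈ cluster A T {site v₀},
          m * ((2 * c * q ^ J₁ + 2 * w + 4) * q ^ (s.2 : ℕ)) := by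
        refine Finset.sum_le_sum fun s _ => ?_
        have hD0 : 0 ≤ Dw s.2 := by simp only [hDw]; positivity
        refine (card_near_le ξ hξ0 hξN hm hD0 _).trans ?_
        rw [mul_comm]
        exact mul_le_mul_of_nonneg_left (hD _) (Nat.cast_nonneg m)
      _ ≤ _ := by
        rw [← Finset.mul_sum, ← Finset.mul_sum]
        refine mul_le_mul_of_nonneg_left (mul_le_mul_of_nonneg_left (hB _) ?_) (Nat.cast_nonneg m)
        positivity
  · push Not at hhigh
    obtain ⟨v₀, hv₀⟩ := C.nonempty_supp
    have hsub : C.supp ⊆ (Finset.univ.filter fun u => near N w (ξ v₀) (ξ u) : Finset V) := by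
      intro u hu
      have hr : G.Reachable v₀ u := by
        rw [← SimpleGraph.ConnectedComponent.eq]
        exact (SimpleGraph.ConnectedComponent.mem_supp_iff _ _ |>.1 hv₀).trans
          (SimpleGraph.ConnectedComponent.mem_supp_iff _ _ |>.1 hu).symm
      rw [Finset.mem_coe, Finset.mem_filter]
      refine ⟨Finset.mem_univ _, near_of_lowAdj_reflTransGen hc hq0 hadj hgap (hhigh _ hv₀) ?_⟩
      rw [SimpleGraph.reachable_iff_reflTransGen] at hr
      have : Relation.ReflTransGen (LowAdj G lay J₁) v₀ u ∧ u ∈ C.supp := by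
        clear hu
        induction hr with
        | refl => exact ⟨.refl, hv₀⟩
        | @tail a b _ hab ih =>
          have hb : b ∈ C.supp := by
            have := ih.2
            rw [SimpleGraph.ConnectedComponent.mem_supp_iff] at this ⊢
            rw [← this]
            exact SimpleGraph.ConnectedComponent.sound hab.symm.reachable
          exact ⟨ih.1.tail ⟨hab, hhigh _ ih.2, hhigh _ hb⟩, hb⟩
      exact this.1
    have hcard := Set.ncard_le_ncard hsub (Finset.finite_toSet _)
    rw [Set.ncard_coe_finset] at hcard
    calc (C.supp.ncard : ℝ) ≤ ((Finset.univ.filter fun u => near N w (ξ v₀) (ξ u)).card : ℝ) := by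
          exact_mod_cast hcard
      _ ≤ (2 * w + 2) * m := card_near_le ξ hξ0 hξN hm hw _
      _ ≤ m * ((2 * c * q ^ J₁ + 2 * w + 4) * 1) := by
        rw [mul_comm]
        refine mul_le_mul_of_nonneg_left ?_ (Nat.cast_nonneg m)
        nlinarith
      _ ≤ _ := by gcongr

end Layered

/-! ### Hyperbolic geometry -/

section Geometry

lemma coshLaw_eq_and_one_le {r₁ r₂ : ℝ} (h1 : 0 ≤ r₁) (h2 : 0 ≤ r₂) (θ : ℝ) :
    Real.cosh (r₁ - r₂) + Real.sinh r₁ * Real.sinh r₂ * (1 - Real.cos θ) =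
      Real.cosh r₁ * Real.cosh r₂ - Real.sinh r₁ * Real.sinh r₂ * Real.cos θ ∧
    1 ≤ Real.cosh r₁ * Real.cosh r₂ - Real.sinh r₁ * Real.sinh r₂ * Real.cos θ := by
  have e : Real.cosh (r₁ - r₂) + Real.sinh r₁ * Real.sinh r₂ * (1 - Real.cos θ) =
      Real.cosh r₁ * Real.cosh r₂ - Real.sinh r₁ * Real.sinh r₂ * Real.cos θ := by
    rw [Real.cosh_sub]; ring
  refine ⟨e, ?_⟩
  rw [← e]
  have a := Real.one_le_cosh (r₁ - r₂)
  have b : 0 ≤ Real.sinh r₁ * Real.sinh r₂ * (1 - Real.cos θ) :=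
    mul_nonneg (mul_nonneg (Real.sinh_nonneg_iff.2 h1) (Real.sinh_nonneg_iff.2 h2))
      (by linarith [Real.cos_le_one θ])
  linarith

lemma hypDist_le_iff {R : ℝ} (hR : 0 ≤ R) {u v : ℝ × ℝ} (hu : 0 ≤ u.1) (hv : 0 ≤ v.1) :
    hypDist u v ≤ R ↔ Real.cosh (u.1 - v.1) +
      Real.sinh u.1 * Real.sinh v.1 * (1 - Real.cos (u.2 - v.2)) ≤ Real.cosh R := by
  obtain ⟨e, h1⟩ := coshLaw_eq_and_one_le hu hv (u.2 - v.2)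
  rw [e, hypDist]
  conv_lhs => rw [← Real.arcosh_cosh hR]
  rw [Real.arcosh_le_arcosh (by linarith) (Real.cosh_pos R)]

lemma exp_div_four_le_sinh {x : ℝ} (hx : 1 ≤ x) : Real.exp x / 4 ≤ Real.sinh x := by
  rw [Real.sinh_eq]
  have h1 : Real.exp (-x) ≤ 1 := Real.exp_le_one_iff.2 (by linarith)
  have h2 := Real.add_one_le_exp x
  linarith

lemma abs_angle_le_of_hypDist_le {R : ℝ} (hR : 0 ≤ R) {u v : ℝ × ℝ} (hu : 1 ≤ u.1) (hv : 1 ≤ v.1)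
    (h : hypDist u v ≤ R) :
    ∃ k : ℤ, |u.2 - v.2 + k * (2 * Real.pi)| ≤ 9 * Real.exp ((R - u.1 - v.1) / 2) := by
  rw [hypDist_le_iff hR (by linarith) (by linarith)] at h
  set θ := u.2 - v.2 with hθ
  have hpi := Real.pi_pos
  have hcos : 1 - Real.cos θ ≤ 16 * Real.exp (R - u.1 - v.1) := by
    have h1 := exp_div_four_le_sinh hu
    have h2 := exp_div_four_le_sinh hv
    have h3 : Real.cosh R ≤ Real.exp R := by
      rw [Real.cosh_eq]
      have := Real.exp_le_exp.2 (by linarith : -R ≤ R)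
      linarith
    have h4 := Real.cosh_pos (u.1 - v.1)
    have h5 : Real.exp u.1 / 4 * (Real.exp v.1 / 4) ≤ Real.sinh u.1 * Real.sinh v.1 :=
      mul_le_mul h1 h2 (by positivity) (le_trans (by positivity) h1)
    have h6 : 0 ≤ 1 - Real.cos θ := by linarith [Real.cos_le_one θ]
    have h7 := mul_le_mul_of_nonneg_right h5 h6
    have h8 : Real.exp (R - u.1 - v.1) = Real.exp R / (Real.exp u.1 * Real.exp v.1) := by
      rw [sub_sub, Real.exp_sub, Real.exp_add]
    rw [h8, mul_div_assoc', le_div_iff₀ (by positivity)]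
    nlinarith
  refine ⟨-round (θ / (2 * Real.pi)), ?_⟩
  set θ' := θ + (-round (θ / (2 * Real.pi)) : ℤ) * (2 * Real.pi) with hθ'
  have hcos' : Real.cos θ' = Real.cos θ := Real.cos_add_int_mul_two_pi _ _
  have habs : |θ'| ≤ Real.pi := by
    have h1 := abs_sub_round (θ / (2 * Real.pi))
    have h2 : θ' = (θ / (2 * Real.pi) - round (θ / (2 * Real.pi))) * (2 * Real.pi) := by
      rw [hθ', sub_mul, div_mul_cancel₀ _ (by positivity)]
      push_cast; ring
    rw [h2, abs_mul, abs_of_pos (by positivity : 0 < 2 * Real.pi)]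
    nlinarith
  have h9 := Real.cos_le_one_sub_mul_cos_sq habs
  rw [hcos'] at h9
  have h10 : θ' ^ 2 ≤ 8 * Real.pi ^ 2 * Real.exp (R - u.1 - v.1) := by
    have : 2 / Real.pi ^ 2 * θ' ^ 2 ≤ 16 * Real.exp (R - u.1 - v.1) := by linarith
    rw [div_mul_eq_mul_div, div_le_iff₀ (by positivity)] at this
    linarith
  have h11 : 8 * Real.pi ^ 2 ≤ 81 := by
    have := Real.pi_lt_d2
    nlinarith
  apply abs_le_of_sq_le_sq _ (by positivity)
  rw [mul_pow, ← Real.exp_nat_mul]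
  have h12 : ((2 : ℕ) : ℝ) * ((R - u.1 - v.1) / 2) = R - u.1 - v.1 := by push_cast; ring
  rw [h12]
  refine h10.trans ?_
  have := Real.exp_pos (R - u.1 - v.1)
  nlinarith

lemma hypDist_le_of_sq_le {R : ℝ} (hR : 2 ≤ R) {u v : ℝ × ℝ} (hu : 1 ≤ u.1) (hv : 1 ≤ v.1)
    (hu' : u.1 ≤ R) (hv' : v.1 ≤ R) (h : (u.2 - v.2) ^ 2 ≤ Real.exp (R - u.1 - v.1)) :
    hypDist u v ≤ R := by
  rw [hypDist_le_iff (by linarith) (by linarith) (by linarith)]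
  have hsinh : ∀ x : ℝ, Real.sinh x ≤ Real.exp x / 2 := fun x => by
    rw [Real.sinh_eq]; linarith [Real.exp_pos (-x)]
  have h1 : Real.cosh (u.1 - v.1) ≤ Real.cosh (R - 1) := by
    rw [Real.cosh_le_cosh, abs_of_nonneg (by linarith : 0 ≤ R - 1), abs_le]
    constructor <;> linarith
  have h2 : 1 - Real.cos (u.2 - v.2) ≤ Real.exp (R - u.1 - v.1) / 2 := by
    have := @Real.one_sub_sq_div_two_le_cos (u.2 - v.2)
    linarith
  have h3 : Real.sinh u.1 * Real.sinh v.1 * (1 - Real.cos (u.2 - v.2)) ≤ Real.exp R / 8 := by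
    calc _ ≤ Real.exp u.1 / 2 * (Real.exp v.1 / 2) * (Real.exp (R - u.1 - v.1) / 2) := by
          have := Real.cos_le_one (u.2 - v.2)
          have a := Real.sinh_nonneg_iff.2 (by linarith : 0 ≤ u.1)
          have b := Real.sinh_nonneg_iff.2 (by linarith : 0 ≤ v.1)
          exact mul_le_mul (mul_le_mul (hsinh _) (hsinh _) b (by positivity)) h2 (by linarith)
            (by positivity)
      _ = _ := by
          rw [sub_sub, Real.exp_sub, Real.exp_add]
          field_simp
          norm_num
  have h4 : Real.cosh (R - 1) + Real.exp R / 8 ≤ Real.cosh R := by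
    rw [Real.cosh_eq, Real.cosh_eq, neg_sub, Real.exp_sub, Real.exp_sub, Real.exp_neg]
    have he := Real.exp_one_gt_d9
    have he' := Real.exp_one_lt_d9
    have hX : 7.29 ≤ Real.exp R := by
      have : Real.exp 1 * Real.exp 1 ≤ Real.exp R := by
        rw [← Real.exp_add]; exact Real.exp_le_exp.2 (by linarith)
      nlinarith
    have a : Real.exp R / Real.exp 1 ≤ 0.4 * Real.exp R := by
      rw [div_le_iff₀ (by positivity)]; nlinarith
    have b : Real.exp 1 / Real.exp R ≤ 0.3 * Real.exp R := by
      rw [div_le_iff₀ (by positivity)]; nlinarith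
    have d : 0 < (Real.exp R)⁻¹ := by positivity
    linarith
  linarith

/-- The angle of a point, in units in which the circle has length `n`. -/
def pos (n : ℕ) (p : ℝ × ℝ) : ℝ := p.2 * n / (2 * Real.pi)

/-- The integer part of the distance of a point to the boundary of the disk. -/
def layer (R : ℝ) (p : ℝ × ℝ) : ℕ := ⌊R - p.1⌋₊

lemma exp_radius_half {ν : ℝ} (hν : 0 < ν) {n : ℕ} (hn : 0 < n) :
    Real.exp (radius ν n / 2) = n / ν := by
  have : (0 : ℝ) < n := by exact_mod_cast hn
  rw [radius, mul_div_cancel_left₀ _ (by norm_num : (2 : ℝ) ≠ 0), Real.exp_log (by positivity)]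

/-- The constant of proportionality in the connection radius. -/
def connConst (ν : ℝ) : ℝ := 9 * ν / (2 * Real.pi) * Real.exp 1

lemma connConst_pos {ν : ℝ} (hν : 0 < ν) : 0 < connConst ν := by
  have := Real.pi_pos
  rw [connConst]; positivity

lemma near_of_hypDist_le {ν : ℝ} (hν : 0 < ν) {n : ℕ} (hn : 0 < n) (hR : 0 ≤ radius ν n)
    {u v : ℝ × ℝ} (hu : 1 ≤ u.1) (hv : 1 ≤ v.1) (h : hypDist u v ≤ radius ν n) :
    near n (connConst ν * Real.exp (1 / 2) ^ (layer (radius ν n) u + layer (radius ν n) v))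
      (pos n u) (pos n v) := by
  obtain ⟨k, hk⟩ := abs_angle_le_of_hypDist_le hR hu hv h
  set R := radius ν n with hRdef
  have hn' : (0 : ℝ) < n := by exact_mod_cast hn
  have hpi := Real.pi_pos
  refine ⟨k, ?_⟩
  have e : pos n u - pos n v + k * n = (u.2 - v.2 + k * (2 * Real.pi)) * (n / (2 * Real.pi)) := by
    rw [pos, pos]; field_simp
  rw [e, abs_mul, abs_of_pos (by positivity : 0 < (n : ℝ) / (2 * Real.pi))]
  have hlu := Nat.lt_floor_add_one (R - u.1)
  have hlv := Nat.lt_floor_add_one (R - v.1)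
  have h1 : Real.exp ((R - u.1 - v.1) / 2) ≤
      ν / n * (Real.exp 1 * Real.exp (1 / 2) ^ (layer R u + layer R v)) := by
    have : (ν / n : ℝ) = Real.exp (-(R / 2)) := by
      rw [Real.exp_neg, exp_radius_half hν hn, inv_div]
    rw [this, ← Real.exp_nat_mul, ← Real.exp_add, ← Real.exp_add]
    refine Real.exp_le_exp.2 ?_
    rw [layer, layer]
    push_cast
    linarith
  calc _ ≤ 9 * (ν / n * (Real.exp 1 * Real.exp (1 / 2) ^ (layer R u + layer R v))) *
        (n / (2 * Real.pi)) := by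
        refine mul_le_mul_of_nonneg_right (hk.trans ?_) (by positivity)
        linarith
    _ = _ := by
        rw [connConst]; field_simp

end Geometry

/-! ### The Poisson distribution -/

section Poisson

open scoped NNReal

lemma integrable_exp_mul_poissonMeasure (l : ℝ≥0) (t : ℝ) :
    Integrable (fun k : ℕ => Real.exp (t * k)) (poissonMeasure l) ∧
      ∫ k : ℕ, Real.exp (t * k) ∂poissonMeasure l = Real.exp (l * (Real.exp t - 1)) := by
  have hs : HasSum (fun k : ℕ => Real.exp (-l) * l ^ k / k.factorial * Real.exp (t * k))
      (Real.exp (l * (Real.exp t - 1))) := by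
    have h := (NormedSpace.expSeries_div_hasSum_exp ((l : ℝ) * Real.exp t)).mul_left
      (Real.exp (-l))
    rw [← Real.exp_eq_exp_ℝ, ← Real.exp_add] at h
    convert! h using 1
    · funext k
      rw [mul_pow, ← Real.exp_nat_mul, mul_comm t]
      ring
    · congr 1; ring
  have hi : Integrable (fun k : ℕ => Real.exp (t * k)) (poissonMeasure l) := by
    rw [integrable_poissonMeasure_iff]
    simpa [abs_of_pos (Real.exp_pos _)] using hs.summable
  refine ⟨hi, ?_⟩
  rw [integral_poissonMeasure' hi]
  simpa using hs.tsum_eq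

lemma poissonMeasure_ge_le (l : ℝ≥0) (hl : l ≤ 1) (x : ℝ) :
    (poissonMeasure l).real {k : ℕ | x ≤ k} ≤ Real.exp (2 - x) := by
  have h := measure_ge_le_exp_mul_mgf (μ := poissonMeasure l) (X := fun k : ℕ => (k : ℝ)) (t := 1) x
    zero_le_one (integrable_exp_mul_poissonMeasure l 1).1
  refine h.trans ?_
  rw [mgf, (integrable_exp_mul_poissonMeasure l 1).2, ← Real.exp_add]
  refine Real.exp_le_exp.2 ?_
  have := Real.exp_one_lt_d9
  have h1 : (l : ℝ) ≤ 1 := by exact_mod_cast hl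
  have h2 : (0 : ℝ) ≤ l := l.2
  nlinarith [Real.exp_one_gt_d9]

lemma poissonMeasure_le_half_le (l : ℝ≥0) :
    (poissonMeasure l).real {k : ℕ | (k : ℝ) ≤ l / 2} ≤ Real.exp (-(l / 10)) := by
  have h := measure_le_le_exp_mul_mgf (μ := poissonMeasure l) (X := fun k : ℕ => (k : ℝ)) (t := -1)
    (l / 2) (by norm_num) (integrable_exp_mul_poissonMeasure l (-1)).1
  refine h.trans ?_
  rw [mgf, (integrable_exp_mul_poissonMeasure l (-1)).2, ← Real.exp_add]
  refine Real.exp_le_exp.2 ?_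
  have h1 : Real.exp (-1) ≤ 0.4 := by
    rw [Real.exp_neg, inv_le_comm₀ (Real.exp_pos _) (by norm_num)]
    linarith [Real.exp_one_gt_d9]
  have h2 : (0 : ℝ) ≤ l := l.2
  nlinarith

end Poisson

section PoissonProcess

variable {Ω E : Type*} [MeasurableSpace Ω] [MeasurableSpace E] {V : Ω → Finset E} {μ : Measure E}
  [IsFiniteMeasure μ] {P : Measure Ω}

lemma IsPoissonProcess.measureReal_count (h : IsPoissonProcess V μ P) {B : Set E}
    (hB : MeasurableSet B) (s : Set ℕ) :
    P.real {ω | count (V ω) B ∈ s} = (poissonMeasure (μ B).toNNReal).real s := by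
  rw [← h.map_count B hB, map_measureReal_apply (h.measurable_count B hB) .of_discrete]
  rfl

lemma IsPoissonProcess.measureReal_count_eq_zero (h : IsPoissonProcess V μ P) {B : Set E}
    (hB : MeasurableSet B) : P.real {ω | count (V ω) B = 0} = Real.exp (-(μ B).toReal) := by
  have := h.measureReal_count hB {0}
  rw [poissonMeasure_real_singleton] at this
  simp only [pow_zero, mul_one, Nat.factorial_zero, Nat.cast_one, div_one] at this
  exact this

lemma IsPoissonProcess.measureReal_count_ne_zero_le [IsProbabilityMeasure P]
    (h : IsPoissonProcess V μ P) {B : Set E}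
    (hB : MeasurableSet B) : P.real {ω | count (V ω) B ≠ 0} ≤ (μ B).toReal := by
  have hm : MeasurableSet {ω | count (V ω) B = 0} :=
    h.measurable_count B hB (MeasurableSet.of_discrete (s := {0}))
  have : {ω | count (V ω) B ≠ 0} = {ω | count (V ω) B = 0}ᶜ := rfl
  rw [this, probReal_compl_eq_one_sub hm, h.measureReal_count_eq_zero hB]
  linarith [Real.add_one_le_exp (-(μ B).toReal)]

lemma IsPoissonProcess.measureReal_ge_count_le (h : IsPoissonProcess V μ P) {B : Set E}
    (hB : MeasurableSet B) (h1 : (μ B).toReal ≤ 1) (x : ℝ) :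
    P.real {ω | x ≤ count (V ω) B} ≤ Real.exp (2 - x) := by
  have := h.measureReal_count hB {k : ℕ | x ≤ k}
  exact this.trans_le (poissonMeasure_ge_le _ (by exact_mod_cast h1) x)

lemma IsPoissonProcess.measureReal_count_le_half (h : IsPoissonProcess V μ P) {B : Set E}
    (hB : MeasurableSet B) :
    P.real {ω | (count (V ω) B : ℝ) ≤ (μ B).toReal / 2} ≤ Real.exp (-((μ B).toReal / 10)) := by
  have := h.measureReal_count hB {k : ℕ | (k : ℝ) ≤ (μ B).toReal / 2}
  exact this.trans_le (poissonMeasure_le_half_le _)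

lemma IsPoissonProcess.iIndepFun_count (h : IsPoissonProcess V μ P) {ι : Type*} [Fintype ι]
    {B : ι → Set E} (hB : ∀ i, MeasurableSet (B i)) (hd : Pairwise fun i j => Disjoint (B i) (B j)) :
    iIndepFun (fun i ω => count (V ω) (B i)) P := by
  have e := (Fintype.equivFin ι).symm
  have := h.indep_count (Fintype.card ι) (fun i => B (e i)) (fun i => hB _)
    fun i j hij => hd (e.injective.ne hij)
  exact (iIndepFun_precomp_of_bijective (f := fun i ω => count (V ω) (B i)) e.bijective).1 this

lemma count_eq_card_filter (S : Finset E) (B : Set E) [DecidablePred (· ∈ B)] :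
    count S B = (S.filter (· ∈ B)).card := by
  rw [count, ← Set.ncard_coe_finset]
  congr 1
  ext; simp

lemma count_ne_zero {S : Finset E} {B : Set E} {x : E} (hx : x ∈ S) (hB : x ∈ B) :
    count S B ≠ 0 := by
  classical
  rw [count_eq_card_filter]
  exact Finset.card_ne_zero_of_mem (Finset.mem_filter.2 ⟨hx, hB⟩)

end PoissonProcess

/-! ### The intensity measure -/

section Intensity

/-- The density of the angular coordinate. -/
def angularDensity (θ : ℝ) : ℝ := if 0 ≤ θ ∧ θ < 2 * Real.pi then 1 / (2 * Real.pi) else 0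

lemma measurable_radialDensity (α R : ℝ) : Measurable (radialDensity α R) := by
  unfold radialDensity
  refine Measurable.ite (measurableSet_Ici.inter measurableSet_Iio) ?_ measurable_const
  fun_prop

lemma measurable_angularDensity : Measurable angularDensity := by
  unfold angularDensity
  exact Measurable.ite (measurableSet_Ici.inter measurableSet_Iio) measurable_const measurable_const

lemma radialDensity_nonneg {α : ℝ} (hα : 0 ≤ α) (R r : ℝ) : 0 ≤ radialDensity α R r := by
  unfold radialDensity
  split_ifs with h
  · exact div_nonneg (mul_nonneg hα (Real.sinh_nonneg_iff.2 (mul_nonneg hα h.1)))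
      (by linarith [Real.one_le_cosh (α * R)])
  · rfl

lemma polarDensity_eq (α R : ℝ) (p : ℝ × ℝ) :
    polarDensity α R p = radialDensity α R p.1 * angularDensity p.2 := by
  unfold polarDensity angularDensity
  split_ifs <;> simp

lemma intensity_prod {α ν : ℝ} (hα : 0 ≤ α) (hν : 0 < ν) {n : ℕ} (hn : 0 < n) {A B : Set ℝ}
    (hA : MeasurableSet A) (hB : MeasurableSet B) :
    intensity α ν n (A ×ˢ B) = n * ((∫⁻ r in A, ENNReal.ofReal (radialDensity α (radius ν n) r)) *
      ∫⁻ θ in B, ENNReal.ofReal (angularDensity θ)) := by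
  rw [intensity, withDensity_apply _ (hA.prod hB), Measure.volume_eq_prod,
    ← Measure.prod_restrict]
  have : ∀ p : ℝ × ℝ, ENNReal.ofReal (intensityFun α ν n p) =
      n * (ENNReal.ofReal (radialDensity α (radius ν n) p.1) *
        ENNReal.ofReal (angularDensity p.2)) := fun p => by
    rw [intensityFun, polarDensity_eq, exp_radius_half hν hn, mul_div_cancel₀ _ hν.ne',
      ENNReal.ofReal_mul (Nat.cast_nonneg n), ENNReal.ofReal_natCast,
      ENNReal.ofReal_mul (radialDensity_nonneg hα _ _)]
  simp_rw [this]
  have h1 := (measurable_radialDensity α (radius ν n)).ennreal_ofReal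
  have h2 := measurable_angularDensity.ennreal_ofReal
  rw [lintegral_const_mul' _ _ (ENNReal.natCast_ne_top n),
    lintegral_prod_mul h1.aemeasurable h2.aemeasurable]

lemma lintegral_angularDensity {a b : ℝ} (ha : 0 ≤ a) (hb : b ≤ 2 * Real.pi) :
    ∫⁻ θ in Set.Ico a b, ENNReal.ofReal (angularDensity θ) =
      ENNReal.ofReal ((b - a) / (2 * Real.pi)) := by
  have hpi := Real.pi_pos
  rw [setLIntegral_congr_fun (g := fun _ => ENNReal.ofReal (1 / (2 * Real.pi)))
    measurableSet_Ico fun θ hθ => by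
      rw [angularDensity, if_pos ⟨ha.trans hθ.1, hθ.2.trans_le hb⟩]]
  rw [setLIntegral_const, Real.volume_Ico, ← ENNReal.ofReal_mul (by positivity)]
  congr 1
  ring

lemma lintegral_angularDensity_le {a b : ℝ} :
    ∫⁻ θ in Set.Ico a b, ENNReal.ofReal (angularDensity θ) ≤
      ENNReal.ofReal ((b - a) / (2 * Real.pi)) := by
  have hpi := Real.pi_pos
  refine (setLIntegral_mono (g := fun _ => ENNReal.ofReal (1 / (2 * Real.pi))) measurable_const
    fun θ _ => ENNReal.ofReal_le_ofReal ?_).trans ?_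
  · unfold angularDensity
    split_ifs
    · rfl
    · positivity
  · rw [setLIntegral_const, Real.volume_Ico, ← ENNReal.ofReal_mul (by positivity)]
    refine ENNReal.ofReal_le_ofReal (le_of_eq ?_)
    ring

lemma sinh_sub_le {a s : ℝ} (hs : 0 ≤ s) : Real.sinh (a - s) ≤ Real.exp (-s) * Real.sinh a := by
  rw [Real.sinh_eq, Real.sinh_eq]
  have h1 : Real.exp (a - s) = Real.exp (-s) * Real.exp a := by rw [← Real.exp_add]; congr 1; ring
  have h2 : Real.exp (-s) * Real.exp (-a) ≤ Real.exp (-(a - s)) := by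
    rw [← Real.exp_add]; exact Real.exp_le_exp.2 (by linarith)
  linarith

lemma cosh_sub_one_eq (x : ℝ) : Real.cosh x - 1 = 2 * Real.sinh (x / 2) ^ 2 := by
  have h1 := Real.cosh_two_mul (x / 2)
  have h2 := Real.cosh_sq (x / 2)
  rw [mul_div_cancel₀ _ (two_ne_zero)] at h1
  linarith

lemma lintegral_radialDensity_le {α R s : ℝ} (hα : 0 < α) (hR : 0 < R) (hs : 0 ≤ s) :
    ∫⁻ r in Set.Iic (R - s), ENNReal.ofReal (radialDensity α R r) ≤
      ENNReal.ofReal (Real.exp (-(α * s))) := by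
  have hc : 0 < Real.cosh (α * R) - 1 := by
    have := Real.one_lt_cosh.2 (mul_pos hα hR).ne'
    linarith
  set f : ℝ → ℝ := fun r => α * Real.sinh (α * r) / (Real.cosh (α * R) - 1) with hf
  have hle : ∫⁻ r in Set.Iic (R - s), ENNReal.ofReal (radialDensity α R r) ≤
      ∫⁻ r in Set.Icc 0 (R - s), ENNReal.ofReal (f r) := by
    rw [← lintegral_indicator measurableSet_Iic, ← lintegral_indicator measurableSet_Icc]
    refine lintegral_mono fun r => ?_
    by_cases h1 : r ∈ Set.Iic (R - s)
    · rw [Set.indicator_of_mem h1]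
      by_cases h0 : 0 ≤ r
      · rw [Set.indicator_of_mem (Set.mem_Icc.2 ⟨h0, h1⟩)]
        refine ENNReal.ofReal_le_ofReal ?_
        unfold radialDensity
        split_ifs
        · rfl
        · exact div_nonneg (mul_nonneg hα.le (Real.sinh_nonneg_iff.2 (mul_nonneg hα.le h0))) hc.le
      · have : radialDensity α R r = 0 := by
          unfold radialDensity; rw [if_neg fun h => h0 h.1]
        simp [this]
    · rw [Set.indicator_of_notMem h1]; exact zero_le
  refine hle.trans ?_
  rcases lt_or_ge (R - s) 0 with h | h
  · rw [Set.Icc_eq_empty (by linarith)]; simp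
  have hcont : Continuous f := by
    rw [hf]; fun_prop
  have hint : ∫ r in (0 : ℝ)..(R - s), f r =
      (Real.cosh (α * (R - s)) - 1) / (Real.cosh (α * R) - 1) := by
    rw [intervalIntegral.integral_eq_sub_of_hasDerivAt
      (f := fun r => Real.cosh (α * r) / (Real.cosh (α * R) - 1)) (f' := f)]
    · simp; ring
    · intro x _
      have := ((hasDerivAt_id x).const_mul α).cosh.div_const (Real.cosh (α * R) - 1)
      convert! this using 1
      simp only [hf, id, mul_one]
      ring
    · exact hcont.intervalIntegrable _ _
  rw [← ofReal_integral_eq_lintegral_ofReal]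
  · rw [integral_Icc_eq_integral_Ioc, ← intervalIntegral.integral_of_le h, hint]
    refine ENNReal.ofReal_le_ofReal ?_
    rw [div_le_iff₀ hc, cosh_sub_one_eq, cosh_sub_one_eq]
    have h1 := sinh_sub_le (a := α * R / 2) (s := α * s / 2) (by positivity)
    have h0 : 0 ≤ Real.sinh (α * R / 2 - α * s / 2) := Real.sinh_nonneg_iff.2 (by nlinarith)
    have h2 := pow_le_pow_left₀ h0 h1 2
    rw [mul_pow, ← Real.exp_nat_mul] at h2
    have e1 : α * (R - s) / 2 = α * R / 2 - α * s / 2 := by ring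
    have e2 : ((2 : ℕ) : ℝ) * (-(α * s / 2)) = -(α * s) := by push_cast; ring
    rw [e2] at h2
    rw [e1]
    linarith
  · exact hcont.integrableOn_Icc
  · filter_upwards [ae_restrict_mem measurableSet_Icc] with r hr
    exact div_nonneg (mul_nonneg hα.le (Real.sinh_nonneg_iff.2 (mul_nonneg hα.le hr.1))) hc.le

/-- A box: the points at distance in `[s, t)` from the boundary of the disk, and with position
in `[a, b)`. -/
def box (R : ℝ) (n : ℕ) (s t a b : ℝ) : Set (ℝ × ℝ) :=
  {p | (s ≤ R - p.1 ∧ R - p.1 < t) ∧ a ≤ pos n p ∧ pos n p < b}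

lemma box_eq_prod {n : ℕ} (hn : 0 < n) (R s t a b : ℝ) :
    box R n s t a b = Set.Ioc (R - t) (R - s) ×ˢ
      Set.Ico (a * (2 * Real.pi) / n) (b * (2 * Real.pi) / n) := by
  have hn' : (0 : ℝ) < n := by exact_mod_cast hn
  have hpi := Real.pi_pos
  ext p
  simp only [box, pos, Set.mem_ofPred_eq, Set.mem_prod, Set.mem_Ioc, Set.mem_Ico]
  rw [div_le_iff₀ hn', lt_div_iff₀ hn', le_div_iff₀ (by positivity), div_lt_iff₀ (by positivity),
    and_comm (a := s ≤ _), sub_lt_comm, le_sub_comm]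

lemma measurableSet_box {n : ℕ} (hn : 0 < n) (R s t a b : ℝ) :
    MeasurableSet (box R n s t a b) := by
  rw [box_eq_prod hn]
  exact measurableSet_Ioc.prod measurableSet_Ico

lemma intensity_box_le {α ν : ℝ} (hα : 0 < α) (hν : 0 < ν) {n : ℕ} (hn : 0 < n)
    (hR : 0 < radius ν n) {s t a b : ℝ} (hs : 0 ≤ s) (hab : a ≤ b) :
    (intensity α ν n (box (radius ν n) n s t a b)).toReal ≤ (b - a) * Real.exp (-(α * s)) := by
  have hn' : (0 : ℝ) < n := by exact_mod_cast hn
  have hpi := Real.pi_pos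
  refine ENNReal.toReal_le_of_le_ofReal (mul_nonneg (sub_nonneg.2 hab) (Real.exp_pos _).le) ?_
  rw [box_eq_prod hn, intensity_prod hα.le hν hn measurableSet_Ioc measurableSet_Ico]
  have h1 : ∫⁻ r in Set.Ioc (radius ν n - t) (radius ν n - s),
      ENNReal.ofReal (radialDensity α (radius ν n) r) ≤ ENNReal.ofReal (Real.exp (-(α * s))) :=
    (lintegral_mono_set Set.Ioc_subset_Iic_self).trans (lintegral_radialDensity_le hα hR hs)
  refine (mul_le_mul_right (mul_le_mul' h1 lintegral_angularDensity_le) _).trans (le_of_eq ?_)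
  rw [← ENNReal.ofReal_natCast, ← ENNReal.ofReal_mul (Real.exp_pos _).le,
    ← ENNReal.ofReal_mul hn'.le]
  congr 1
  field_simp

lemma le_intensity_box {α ν : ℝ} (hα : 1 ≤ α) (hν : 0 < ν) {n : ℕ} (hn : 0 < n)
    {s a b : ℝ} (hs : 0 ≤ s) (hsR : s + 1 + 1 ≤ radius ν n) (ha : 0 ≤ a)
    (hb : b ≤ n) :
    (b - a) * (Real.exp (-(α * (s + 1))) / 4) ≤
      (intensity α ν n (box (radius ν n) n s (s + 1) a b)).toReal := by
  have hn' : (0 : ℝ) < n := by exact_mod_cast hn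
  have hpi := Real.pi_pos
  set R := radius ν n with hR
  have hα0 : 0 < α := by linarith
  have hc : 0 < Real.cosh (α * R) - 1 := by
    have := Real.one_lt_cosh.2 (mul_pos hα0 (by linarith : 0 < R)).ne'
    linarith
  refine (ENNReal.ofReal_le_iff_le_toReal (measure_ne_top _ _)).1 ?_
  rw [box_eq_prod hn, intensity_prod hα0.le hν hn measurableSet_Ioc measurableSet_Ico,
    lintegral_angularDensity (by positivity)
      (by rw [div_le_iff₀ hn']; nlinarith)]
  have h1 : ENNReal.ofReal (Real.exp (-(α * (s + 1))) / 4) ≤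
      ∫⁻ r in Set.Ioc (R - (s + 1)) (R - s), ENNReal.ofReal (radialDensity α R r) := by
    have hIoc : ∫⁻ r in Set.Ioc (R - (s + 1)) (R - s), ENNReal.ofReal (radialDensity α R r) =
        ∫⁻ r in Set.Ioo (R - (s + 1)) (R - s), ENNReal.ofReal (radialDensity α R r) := by
      rw [restrict_Ioo_eq_restrict_Ioc]
    rw [hIoc]
    refine le_trans (le_of_eq ?_) (setLIntegral_mono
      (f := fun _ => ENNReal.ofReal (Real.exp (-(α * (s + 1))) / 4))
      ((measurable_radialDensity α R).ennreal_ofReal) fun r hr => ENNReal.ofReal_le_ofReal ?_)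
    · rw [setLIntegral_const, Real.volume_Ioo]
      simp
    · have hr1 : 1 ≤ r := by linarith [hr.1]
      rw [radialDensity, if_pos ⟨by linarith, by linarith [hr.2]⟩, le_div_iff₀ hc]
      have h2 : Real.exp (α * r) / 4 ≤ Real.sinh (α * r) := exp_div_four_le_sinh (by nlinarith)
      have h3 : Real.cosh (α * R) ≤ Real.exp (α * R) := by
        rw [Real.cosh_eq]
        have := Real.exp_le_exp.2 (by nlinarith : -(α * R) ≤ α * R)
        linarith
      have h4 : Real.exp (-(α * (s + 1))) * Real.exp (α * R) ≤ Real.exp (α * r) := by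
        rw [← Real.exp_add]
        refine Real.exp_le_exp.2 ?_
        have := mul_le_mul_of_nonneg_left hr.1.le hα0.le
        linarith
      have h5 := Real.exp_pos (-(α * (s + 1)))
      have h6 := Real.exp_pos (α * r)
      nlinarith
  refine le_trans (le_of_eq ?_) (mul_le_mul_right (mul_le_mul_left h1 _) _)
  rw [← ENNReal.ofReal_natCast, ← ENNReal.ofReal_mul (by positivity),
    ← ENNReal.ofReal_mul hn'.le]
  congr 1
  field_simp

/-- The disk with radial coordinate in `[0, R)` and angle in `[0, 2π)`. -/
def disk (R : ℝ) : Set (ℝ × ℝ) := Set.Ico 0 R ×ˢ Set.Ico 0 (2 * Real.pi)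

lemma measurableSet_disk (R : ℝ) : MeasurableSet (disk R) :=
  measurableSet_Ico.prod measurableSet_Ico

lemma intensity_compl_disk (α ν : ℝ) (n : ℕ) : intensity α ν n (disk (radius ν n))ᶜ = 0 := by
  rw [intensity, withDensity_apply _ (measurableSet_disk _).compl]
  refine (setLIntegral_congr_fun (g := fun _ => 0) (measurableSet_disk _).compl fun p hp => ?_).trans
    (by simp)
  have : intensityFun α ν n p = 0 := by
    unfold intensityFun polarDensity radialDensity
    split_ifs with h1 h2
    · exact absurd ⟨⟨h2.1, h2.2⟩, h1⟩ hp
    · simp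
    · simp
  simp [this]

end Intensity

/-! ### The upper bound -/

section Upper

/-- The region whose emptiness makes `y` a gap for the layers below `J₁`. -/
def gapSet (R : ℝ) (n J₁ : ℕ) (c y : ℝ) : Set (ℝ × ℝ) :=
  ⋃ j ∈ Finset.range J₁, box R n j (j + 1) (y - c * Real.exp (1 / 2) ^ (2 * j))
    (y + c * Real.exp (1 / 2) ^ (2 * j))

lemma measurableSet_gapSet {n : ℕ} (hn : 0 < n) (R : ℝ) (J₁ : ℕ) (c y : ℝ) :
    MeasurableSet (gapSet R n J₁ c y) :=
  Finset.measurableSet_biUnion _ fun _ _ => measurableSet_box hn _ _ _ _ _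

/-- The centre of the `l`-th block of the `g`-th group, for `G` groups of `L` blocks. -/
def centre (n G L g l : ℕ) : ℝ := (g * L + l + 1 / 2) * (n / (G * L))

lemma exp_half_pow_two_mul (j : ℕ) : Real.exp (1 / 2) ^ (2 * j) = Real.exp 1 ^ j := by
  rw [pow_mul, ← Real.exp_nat_mul]
  norm_num

lemma sum_range_geom_le {β : ℝ} (h0 : 0 ≤ β) (h1 : β < 1) (k : ℕ) :
    ∑ i ∈ Finset.range k, β ^ i ≤ 1 / (1 - β) := by
  have h := mul_neg_geom_sum β k
  rw [le_div_iff₀ (by linarith), mul_comm, h]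
  have : 0 ≤ β ^ k := by positivity
  linarith

lemma exp_mul_pow_eq (α : ℝ) (j : ℕ) :
    Real.exp (1 / 2) ^ (2 * j) * Real.exp (-(α * j)) = Real.exp (1 - α) ^ j := by
  rw [exp_half_pow_two_mul, ← Real.exp_nat_mul, ← Real.exp_nat_mul, ← Real.exp_add]
  congr 1; ring

lemma intensity_gapSet_le {α ν : ℝ} (hα : 1 < α) (hν : 0 < ν) {n : ℕ} (hn : 0 < n)
    (hR : 0 < radius ν n) (J₁ : ℕ) {c : ℝ} (hc : 0 < c) (y : ℝ) :
    (intensity α ν n (gapSet (radius ν n) n J₁ c y)).toReal ≤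
      2 * c / (1 - Real.exp (1 - α)) := by
  have hβ : Real.exp (1 - α) < 1 := Real.exp_lt_one_iff.2 (by linarith)
  refine (measureReal_biUnion_finset_le (μ := intensity α ν n) _ _).trans ?_
  calc _ ≤ ∑ j ∈ Finset.range J₁, 2 * c * Real.exp (1 - α) ^ j := by
        refine Finset.sum_le_sum fun j _ => ?_
        have hq : 0 < Real.exp (1 / 2) ^ (2 * j) := by positivity
        refine (intensity_box_le (by linarith) hν hn hR (Nat.cast_nonneg j) (by nlinarith)).trans ?_
        rw [← exp_mul_pow_eq]
        apply le_of_eq; ring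
    _ ≤ _ := by
        rw [← Finset.mul_sum, ← mul_one_div (2 * c)]
        exact mul_le_mul_of_nonneg_left (sum_range_geom_le (Real.exp_pos (1 - α)).le hβ J₁)
          (by positivity)

lemma disjoint_gapSet {R : ℝ} {n J₁ : ℕ} {c y y' : ℝ} (hc : 0 < c)
    (h : y + 2 * (c * Real.exp (1 / 2) ^ (2 * J₁)) ≤ y') :
    Disjoint (gapSet R n J₁ c y) (gapSet R n J₁ c y') := by
  rw [Set.disjoint_left]
  intro p hp hp'
  simp only [gapSet, Set.mem_iUnion, Finset.mem_range] at hp hp'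
  obtain ⟨j, hj, hp⟩ := hp
  obtain ⟨j', hj', hp'⟩ := hp'
  have hq : (1 : ℝ) ≤ Real.exp (1 / 2) := Real.one_le_exp (by norm_num)
  have h1 : Real.exp (1 / 2) ^ (2 * j) ≤ Real.exp (1 / 2) ^ (2 * J₁) :=
    pow_le_pow_right₀ hq (by omega)
  have h2 : Real.exp (1 / 2) ^ (2 * j') ≤ Real.exp (1 / 2) ^ (2 * J₁) :=
    pow_le_pow_right₀ hq (by omega)
  have a := hp.2.2
  have b := hp'.2.1
  nlinarith

lemma centre_add_le {n G L g l l' : ℕ} (hG : 0 < G) (hL : 0 < L) (h : l < l') {δ : ℝ}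
    (hδ : δ * (G * L) ≤ n) : centre n G L g l + δ ≤ centre n G L g l' := by
  have hG' : (0 : ℝ) < G := by exact_mod_cast hG
  have hL' : (0 : ℝ) < L := by exact_mod_cast hL
  have hl : (l : ℝ) + 1 ≤ l' := by exact_mod_cast h
  have h1 : δ ≤ n / (G * L) := by rwa [le_div_iff₀ (by positivity)]
  have h2 : (0 : ℝ) ≤ n / (G * L) := by positivity
  rw [centre, centre]
  nlinarith

lemma measureReal_forall_gapSet_le {Ω : Type*} [MeasurableSpace Ω] {P : Measure Ω}
    [IsProbabilityMeasure P] {α ν : ℝ} (hα : 1 < α) (hν : 0 < ν) {n : ℕ} (hn : 0 < n)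
    (hR : 0 < radius ν n) {V : Ω → Finset (ℝ × ℝ)} (hV : IsPoi α ν n V P) {J₁ G L : ℕ}
    (hG : 0 < G) (hL : 0 < L) {c : ℝ} (hc : 0 < c)
    (hGL : 2 * (c * Real.exp (1 / 2) ^ (2 * J₁)) * (G * L) ≤ n) (g : ℕ) :
    P.real {ω | ∀ l < L, count (V ω) (gapSet (radius ν n) n J₁ c (centre n G L g l)) ≠ 0} ≤
      (1 - Real.exp (-(2 * c / (1 - Real.exp (1 - α))))) ^ L := by
  set B : Fin L → Set (ℝ × ℝ) := fun l => gapSet (radius ν n) n J₁ c (centre n G L g l) with hB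
  have hmeas : ∀ l, MeasurableSet (B l) := fun l => measurableSet_gapSet hn _ _ _ _
  have hdis : Pairwise fun i j => Disjoint (B i) (B j) := by
    intro i j hij
    rcases lt_or_gt_of_ne (fun h => hij (Fin.ext h) : (i : ℕ) ≠ j) with h | h
    · exact disjoint_gapSet hc (centre_add_le hG hL h hGL)
    · exact (disjoint_gapSet hc (centre_add_le hG hL h hGL)).symm
  have hind := hV.iIndepFun_count hmeas hdis
  have hset : {ω | ∀ l < L, count (V ω) (gapSet (radius ν n) n J₁ c (centre n G L g l)) ≠ 0} =
      ⋂ l ∈ (Finset.univ : Finset (Fin L)), (fun ω => count (V ω) (B l)) ⁻¹' {0}ᶜ := by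
    ext ω
    simp only [Set.mem_ofPred_eq, Finset.mem_univ, Set.iInter_true, Set.mem_iInter,
      Set.mem_preimage, Set.mem_compl_iff, Set.mem_singleton_iff]
    exact ⟨fun h l => h l l.2, fun h l hl => h ⟨l, hl⟩⟩
  rw [hset, measureReal_def, hind.measure_inter_preimage_eq_mul Finset.univ
    (fun _ _ => MeasurableSet.of_discrete), ENNReal.toReal_prod]
  refine (Finset.prod_le_prod (g := fun _ => 1 - Real.exp (-(2 * c / (1 - Real.exp (1 - α)))))
    (fun _ _ => ENNReal.toReal_nonneg) fun l _ => ?_).trans (by simp)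
  have hm : MeasurableSet {ω | count (V ω) (B l) = 0} :=
    hV.measurable_count (B l) (hmeas l) (MeasurableSet.of_discrete (s := {0}))
  have hcompl : (fun ω => count (V ω) (B l)) ⁻¹' {0}ᶜ = {ω | count (V ω) (B l) = 0}ᶜ := rfl
  rw [hcompl, ← measureReal_def, probReal_compl_eq_one_sub hm,
    hV.measureReal_count_eq_zero (hmeas l)]
  have := Real.exp_le_exp.2 (neg_le_neg (intensity_gapSet_le hα hν hn hR J₁ hc
    (centre n G L g l)))
  linarith

lemma mem_of_count_compl_eq_zero {S : Finset (ℝ × ℝ)} {B : Set (ℝ × ℝ)} (h : count S Bᶜ = 0)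
    {p : ℝ × ℝ} (hp : p ∈ S) : p ∈ B := by
  by_contra hB
  exact count_ne_zero hp hB h

lemma pos_nonneg_of_mem_disk {R : ℝ} {n : ℕ} {p : ℝ × ℝ} (hp : p ∈ disk R) : 0 ≤ pos n p := by
  have h1 := hp.2.1
  have := Real.pi_pos
  rw [pos]; positivity

lemma pos_lt_of_mem_disk {R : ℝ} {n : ℕ} (hn : 0 < n) {p : ℝ × ℝ} (hp : p ∈ disk R) :
    pos n p < n := by
  have h1 := hp.2.2
  have hn' : (0 : ℝ) < n := by exact_mod_cast hn
  have := Real.pi_pos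
  rw [pos, div_lt_iff₀ (by positivity)]
  nlinarith

lemma layer_le {R : ℝ} {p : ℝ × ℝ} (hp : p ∈ disk R) : (layer R p : ℝ) ≤ R - p.1 :=
  Nat.floor_le (by linarith [hp.1.2])

lemma lt_layer_add_one (R : ℝ) (p : ℝ × ℝ) : R - p.1 < layer R p + 1 := Nat.lt_floor_add_one _

lemma isGap_of_count_eq_zero {R : ℝ} {n J₁ : ℕ} (hn : 0 < n) {c y : ℝ} (hc : 0 < c)
    {S : Finset (ℝ × ℝ)} (hdisk : count S (disk R)ᶜ = 0) (h : count S (gapSet R n J₁ c y) = 0)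
    (hy1 : c * Real.exp (1 / 2) ^ (2 * J₁) ≤ y) (hy2 : y + c * Real.exp (1 / 2) ^ (2 * J₁) ≤ n)
    (k : ℤ) :
    IsGap (fun v : S => pos n v) (fun v : S => layer R v) n J₁ c (Real.exp (1 / 2))
      (y + k * n) := by
  intro v hv k'
  by_contra hcon
  push Not at hcon
  have hvd := mem_of_count_compl_eq_zero hdisk v.2
  have hq : (1 : ℝ) ≤ Real.exp (1 / 2) := Real.one_le_exp (by norm_num)
  have h1 : c * Real.exp (1 / 2) ^ (2 * layer R v) ≤ c * Real.exp (1 / 2) ^ (2 * J₁) :=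
    mul_le_mul_of_nonneg_left (pow_le_pow_right₀ hq (by simp only at hv; omega)) hc.le
  have hp0 := pos_nonneg_of_mem_disk (n := n) hvd
  have hpn := pos_lt_of_mem_disk hn hvd
  have hn' : (0 : ℝ) < n := by exact_mod_cast hn
  rw [abs_lt] at hcon
  have hkk : k' = k := by
    have e1 : ((k' - k : ℤ) : ℝ) * n < 1 * n := by push_cast; linarith
    have e2 : -1 * (n : ℝ) < ((k' - k : ℤ) : ℝ) * n := by push_cast; linarith
    have e3 := lt_of_mul_lt_mul_right e1 hn'.le
    have e4 := lt_of_mul_lt_mul_right e2 hn'.le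
    have e5 : k' - k < 1 := by exact_mod_cast e3
    have e6 : -1 < k' - k := by exact_mod_cast e4
    omega
  subst hkk
  refine count_ne_zero v.2 ?_ h
  simp only [gapSet, Set.mem_iUnion, Finset.mem_range]
  exact ⟨layer R v, hv, ⟨layer_le hvd, lt_layer_add_one R v⟩, by linarith, by linarith⟩

lemma exists_gap {R : ℝ} {n J₁ G L : ℕ} (hn : 0 < n) (hG : 0 < G) (hL : 0 < L) {c : ℝ} (hc : 0 < c)
    (hGL : 2 * (c * Real.exp (1 / 2) ^ (2 * J₁)) * (G * L) ≤ n)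
    {S : Finset (ℝ × ℝ)} (hdisk : count S (disk R)ᶜ = 0)
    (h : ∀ g < G, ∃ l < L, count S (gapSet R n J₁ c (centre n G L g l)) = 0) (x : ℝ) :
    ∃ y, x ≤ y ∧ y ≤ x + 2 * (n / G) ∧
      IsGap (fun v : S => pos n v) (fun v : S => layer R v) n J₁ c (Real.exp (1 / 2)) y := by
  have hn' : (0 : ℝ) < n := by exact_mod_cast hn
  have hG' : (0 : ℝ) < G := by exact_mod_cast hG
  have hL' : (0 : ℝ) < L := by exact_mod_cast hL
  have hGz : (0 : ℤ) < G := by exact_mod_cast hG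
  set z := ⌈x * G / n⌉ with hz
  have hmod := Int.emod_nonneg z hGz.ne'
  have hmod' := Int.emod_lt_of_pos z hGz
  obtain ⟨l, hl, hcount⟩ := h (z % G).toNat (by omega)
  set g := (z % G).toNat with hg
  have hgz : ((g : ℕ) : ℝ) = z - G * (z / G : ℤ) := by
    have h1 : ((g : ℕ) : ℤ) = z - G * (z / G) := by
      have := Int.emod_add_mul_ediv z G
      omega
    exact_mod_cast h1
  have hl' : (l : ℝ) + 1 ≤ L := by exact_mod_cast hl
  have hgG : (g : ℝ) + 1 ≤ G := by
    have : g + 1 ≤ G := by omega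
    exact_mod_cast this
  have hδ : c * Real.exp (1 / 2) ^ (2 * J₁) ≤ 1 / 2 * (n / (G * L)) := by
    have : 2 * (c * Real.exp (1 / 2) ^ (2 * J₁)) ≤ n / (G * L) := by
      rwa [le_div_iff₀ (by positivity)]
    linarith
  have hu : (0 : ℝ) < n / (G * L) := by positivity
  have hnGL : (n : ℝ) = G * L * (n / (G * L)) := by field_simp
  have hnG : (n : ℝ) / G = L * (n / (G * L)) := by field_simp
  refine ⟨centre n G L g l + (z / G : ℤ) * n, ?_, ?_, ?_⟩
  · have h1 : x * G / n ≤ z := Int.le_ceil _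
    have h2 : x ≤ z * (n / G) := by
      rw [div_le_iff₀ hn'] at h1
      rw [mul_div_assoc', le_div_iff₀ hG']; linarith
    have h3 : (z : ℝ) * (n / G) = g * (n / G) + (z / G : ℤ) * n := by
      rw [hgz]; field_simp; ring
    have h4 : (g : ℝ) * (n / G) ≤ centre n G L g l := by
      rw [hnG, centre]
      have : (0 : ℝ) ≤ l := Nat.cast_nonneg l
      nlinarith
    linarith
  · have h1 : (z : ℝ) < x * G / n + 1 := Int.ceil_lt_add_one _
    have h2 : (z : ℝ) * (n / G) ≤ x + n / G := by
      have : (z : ℝ) * (n / G) ≤ (x * G / n + 1) * (n / G) :=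
        mul_le_mul_of_nonneg_right h1.le (by positivity)
      refine this.trans (le_of_eq ?_)
      field_simp
    have h3 : (z : ℝ) * (n / G) = g * (n / G) + (z / G : ℤ) * n := by
      rw [hgz]; field_simp; ring
    have h4 : centre n G L g l ≤ g * (n / G) + n / G := by
      rw [hnG, centre]
      nlinarith
    linarith
  · refine isGap_of_count_eq_zero hn hc hdisk hcount (hδ.trans ?_) ?_ _
    · rw [centre]
      have : (0 : ℝ) ≤ g * L + l := by positivity
      nlinarith
    · have h5 : centre n G L g l + 1 / 2 * (n / (G * L)) ≤ G * L * (n / (G * L)) := by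
        rw [centre]
        have : ((g : ℝ) + 1) * L ≤ G * L := by nlinarith
        nlinarith
      linarith

/-- The cell of the site `s`. -/
def cell (R : ℝ) (n : ℕ) {J : ℕ} (s : Fin n × Fin J) : Set (ℝ × ℝ) :=
  box R n (s.2 : ℕ) ((s.2 : ℕ) + 1) (s.1 : ℕ) ((s.1 : ℕ) + 1)

lemma disjoint_cell (R : ℝ) (n : ℕ) {J : ℕ} :
    Pairwise fun s t : Fin n × Fin J => Disjoint (cell R n s) (cell R n t) := by
  intro s t hst
  rw [Set.disjoint_left]
  rintro p ⟨⟨h1, h2⟩, h3, h4⟩ ⟨⟨h5, h6⟩, h7, h8⟩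
  apply hst
  have key : ∀ a b : ℕ, ∀ x : ℝ, (a : ℝ) ≤ x → x < a + 1 → (b : ℝ) ≤ x → x < b + 1 → a = b := by
    intro a b x ha ha' hb hb'
    have e1 : (a : ℝ) < b + 1 := by linarith
    have e2 : (b : ℝ) < a + 1 := by linarith
    have e3 : a < b + 1 := by exact_mod_cast e1
    have e4 : b < a + 1 := by exact_mod_cast e2
    omega
  exact Prod.ext (Fin.ext (key _ _ _ h3 h4 h7 h8)) (Fin.ext (key _ _ _ h1 h2 h5 h6))

open Classical in
/-- The set of occupied cells. -/
def occupied (R : ℝ) (n J : ℕ) (S : Finset (ℝ × ℝ)) : Finset (Fin n × Fin J) :=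
  Finset.univ.filter fun s => count S (cell R n s) ≠ 0

open Classical in
/-- The size of a largest component when the configuration is typical. -/
theorem largestComponentSize_le {ν : ℝ} (hν : 0 < ν) {n : ℕ} (hn : 0 < n)
    {J J₁ G L m : ℕ} (hG : 0 < G) (hL : 0 < L) (hJ : (J : ℝ) + 1 ≤ radius ν n)
    (hGL : 2 * (connConst ν * Real.exp (1 / 2) ^ (2 * J₁)) * (G * L) ≤ n)
    {ω : ℝ} (hω : 2 * (n / G : ℝ) ≤ ω * Real.exp (1 / 2) ^ (2 * J₁))
    {S : Finset (ℝ × ℝ)} (hdisk : count S (disk (radius ν n))ᶜ = 0)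
    (hheight : count S (box (radius ν n) n J (radius ν n + 1) 0 n) = 0)
    (hcell : ∀ i < n, count S (box (radius ν n) n 0 (radius ν n + 1) (i : ℕ) ((i : ℕ) + 1)) ≤ m)
    (hgap : ∀ g < G, ∃ l < L,
      count S (gapSet (radius ν n) n J₁ (connConst ν) (centre n G L g l)) = 0)
    {B : ℝ} (hB1 : 1 ≤ B)
    (hB : ∀ s, ∑ t ∈ cluster (siteAdj n J J₁ (2 * connConst ν + ω + 1) (Real.exp (1 / 2)))
      (occupied (radius ν n) n J S) {s}, Real.exp (1 / 2) ^ (t.2 : ℕ) ≤ B) :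
    (largestComponentSize (graph (radius ν n) S) : ℝ) ≤
      m * ((2 * connConst ν * Real.exp (1 / 2) ^ J₁ + 2 * (2 * (n / G : ℝ)) + 4) * B) := by
  set R := radius ν n with hR
  have hc := connConst_pos hν
  have hn' : (0 : ℝ) < n := by exact_mod_cast hn
  have hR0 : 0 ≤ R := by linarith [(Nat.cast_nonneg J : (0 : ℝ) ≤ J)]
  have hq : (1 : ℝ) ≤ Real.exp (1 / 2) := Real.one_le_exp (by norm_num)
  have hmem : ∀ v : S, (v : ℝ × ℝ) ∈ disk R := fun v => mem_of_count_compl_eq_zero hdisk v.2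
  have hJv : ∀ v : S, R - (v : ℝ × ℝ).1 < J := by
    intro v
    by_contra hcon
    push Not at hcon
    refine count_ne_zero v.2 ?_ hheight
    exact ⟨⟨hcon, by linarith [(hmem v).1.1]⟩, pos_nonneg_of_mem_disk (hmem v),
      pos_lt_of_mem_disk hn (hmem v)⟩
  have hω0 : 0 ≤ ω := by
    by_contra hcon
    push Not at hcon
    have h1 : 0 ≤ 2 * (n / G : ℝ) := by positivity
    have h2 : 0 < Real.exp (1 / 2) ^ (2 * J₁) := by positivity
    nlinarith
  have key : ∀ C : (graph R S).ConnectedComponent, (C.supp.ncard : ℝ) ≤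
      m * ((2 * connConst ν * Real.exp (1 / 2) ^ J₁ + 2 * (2 * (n / G : ℝ)) + 4) * B) := by
    intro C
    refine ncard_supp_le (G := graph R S) (ξ := fun v : S => pos n v)
      (lay := fun v : S => layer R v) (N := n) hc hq (J := J)
      (fun v => pos_nonneg_of_mem_disk (hmem v)) (fun v => pos_lt_of_mem_disk hn (hmem v))
      (fun v => ?_) (fun u v huv => ?_) (by positivity) hω0 hω
      (exists_gap hn hG hL hc hGL hdisk hgap) (fun i hi => ?_) (occupied R n J S)
      (fun v s h1 h2 => ?_) hB1 hB C
    · exact (Nat.floor_lt (by linarith [(hmem v).1.2])).2 (hJv v)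
    · exact near_of_hypDist_le hν hn hR0 (by linarith [hJv u]) (by linarith [hJv v]) huv.2
    · refine le_trans ?_ (hcell i hi)
      rw [count_eq_card_filter]
      refine Finset.card_le_card_of_injOn Subtype.val (fun v hv => ?_)
        (Subtype.val_injective.injOn)
      have hv := (Finset.mem_filter.1 hv).2
      have h0 := pos_nonneg_of_mem_disk (n := n) (hmem v)
      rw [Finset.mem_coe, Finset.mem_filter]
      refine ⟨v.2, ⟨by linarith [(hmem v).1.2], by linarith [(hmem v).1.1]⟩, ?_, ?_⟩
      · rw [← hv]; exact Nat.floor_le h0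
      · rw [← hv]; exact Nat.lt_floor_add_one _
    · refine Finset.mem_filter.2 ⟨Finset.mem_univ _, count_ne_zero v.2 ?_⟩
      refine ⟨⟨?_, ?_⟩, ?_, ?_⟩
      · rw [h2]; exact layer_le (hmem v)
      · rw [h2]; exact lt_layer_add_one R v
      · rw [h1]; exact Nat.floor_le (pos_nonneg_of_mem_disk (hmem v))
      · rw [h1]; exact Nat.lt_floor_add_one _
  have hbnd : 0 ≤ m * ((2 * connConst ν * Real.exp (1 / 2) ^ J₁ + 2 * (2 * (n / G : ℝ)) + 4) * B) := by
    have : 0 ≤ B := by linarith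
    positivity
  refine le_trans ?_ (Nat.floor_le hbnd)
  exact_mod_cast ciSup_le' fun C => Nat.le_floor (key C)

end Upper

section UpperProbability

lemma sum_filter_fin_geom_le {β : ℝ} (h0 : 0 ≤ β) (h1 : β < 1) (J J₁ : ℕ) :
    ∑ j ∈ Finset.univ.filter (fun j : Fin J => J₁ ≤ (j : ℕ)), β ^ (j : ℕ) ≤ β ^ J₁ / (1 - β) := by
  have h : ∑ j ∈ Finset.univ.filter (fun j : Fin J => J₁ ≤ (j : ℕ)), β ^ (j : ℕ) = ∑ j ∈ Finset.Ico J₁ J, β ^ j := by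
    rw [Finset.sum_filter, Fin.sum_univ_eq_sum_range (fun j => if J₁ ≤ j then β ^ j else 0),
      ← Finset.sum_filter]
    refine Finset.sum_congr ?_ fun _ _ => rfl
    ext j; simp; omega
  rw [h, Finset.sum_Ico_eq_sum_range]
  simp_rw [pow_add]
  rw [← Finset.mul_sum, ← mul_one_div (β ^ J₁)]
  exact mul_le_mul_of_nonneg_left (sum_range_geom_le h0 h1 _) (by positivity)

open Classical in
lemma card_fin_near_le {n : ℕ} {D : ℝ} (hD : 1 ≤ D) (x : ℝ) :
    ((Finset.univ.filter fun i : Fin n => near n D x ((i : ℕ) : ℝ)).card : ℝ) ≤ 4 * D := by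
  have := card_near_le (m := 1) (fun i : Fin n => ((i : ℕ) : ℝ)) (fun i => Nat.cast_nonneg _)
    (fun i => by exact_mod_cast i.2) (fun i hi => ?_) (by linarith : 0 ≤ D) x
  · rw [Nat.cast_one] at this
    linarith
  · refine Finset.card_le_one.2 fun a ha b hb => ?_
    simp only [Nat.floor_natCast, Finset.mem_filter, Finset.mem_univ, true_and] at ha hb
    exact Fin.ext (ha.trans hb.symm)

open Classical in
lemma sum_siteAdj_le {α K : ℝ} (hα : 1 < α) (hK : 1 ≤ K) {n J J₁ : ℕ}
    {p g : Fin n × Fin J → ℝ} (hp0 : ∀ s, 0 ≤ p s)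
    (hp : ∀ s, p s ≤ Real.exp (-(α * (s.2 : ℕ)))) {ε : ℝ} (hε : 0 ≤ ε)
    (hg : ∀ s, g s ≤ 4 * (ε * Real.exp (1 / 2) ^ (s.2 : ℕ)))
    (hKJ : 16 * K * Real.exp (1 - α) ^ J₁ ≤ 1 - Real.exp (1 - α)) (v : Fin n × Fin J) :
    ∑ u with siteAdj n J J₁ K (Real.exp (1 / 2)) v u, p u * g u ≤
      ε * Real.exp (1 / 2) ^ (v.2 : ℕ) := by
  set q := Real.exp (1 / 2) with hqdef
  have hq : (1 : ℝ) ≤ q := Real.one_le_exp (by norm_num)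
  have hq0 : 0 < q := by linarith
  set β := Real.exp (1 - α) with hβdef
  have hβ0 : 0 < β := Real.exp_pos _
  have hβ : β < 1 := Real.exp_lt_one_iff.2 (by linarith)
  have hterm : ∀ u : Fin n × Fin J, p u * g u ≤
      Real.exp (-(α * (u.2 : ℕ))) * (4 * (ε * q ^ (u.2 : ℕ))) := fun u =>
    (mul_le_mul_of_nonneg_left (hg u) (hp0 u)).trans
      (mul_le_mul_of_nonneg_right (hp u) (by positivity))
  calc _ ≤ ∑ u with siteAdj n J J₁ K q v u,
        Real.exp (-(α * (u.2 : ℕ))) * (4 * (ε * q ^ (u.2 : ℕ))) :=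
        Finset.sum_le_sum fun u _ => hterm u
    _ = ∑ j : Fin J, ∑ i : Fin n, if siteAdj n J J₁ K q v (i, j) then
        Real.exp (-(α * (j : ℕ))) * (4 * (ε * q ^ (j : ℕ))) else 0 := by
        rw [Finset.sum_filter, Fintype.sum_prod_type_right]
    _ ≤ ∑ j : Fin J, if J₁ ≤ (j : ℕ) then 16 * K * ε * q ^ (v.2 : ℕ) * β ^ (j : ℕ) else 0 := by
        refine Finset.sum_le_sum fun j _ => ?_
        rw [← Finset.sum_filter, Finset.sum_const, nsmul_eq_mul]
        by_cases hj : J₁ ≤ (j : ℕ)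
        · rw [if_pos hj]
          simp only [siteAdj, hj, true_and]
          have hone : 1 ≤ K * q ^ ((v.2 : ℕ) + (j : ℕ)) := by
            have := one_le_pow₀ hq (n := (v.2 : ℕ) + (j : ℕ))
            nlinarith
          refine (mul_le_mul_of_nonneg_right (card_fin_near_le hone _) (by positivity)).trans
            (le_of_eq ?_)
          rw [hβdef, ← exp_mul_pow_eq, pow_add, two_mul (j : ℕ), pow_add]
          ring
        · simp [siteAdj, hj]
    _ = 16 * K * ε * q ^ (v.2 : ℕ) * ∑ j ∈ Finset.univ.filter (fun j : Fin J => J₁ ≤ (j : ℕ)), β ^ (j : ℕ) := by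
        rw [← Finset.sum_filter, Finset.mul_sum]
    _ ≤ 16 * K * ε * q ^ (v.2 : ℕ) * (β ^ J₁ / (1 - β)) :=
        mul_le_mul_of_nonneg_left (sum_filter_fin_geom_le hβ0.le hβ _ _) (by positivity)
    _ ≤ ε * q ^ (v.2 : ℕ) := by
        have h1 : 16 * K * (β ^ J₁ / (1 - β)) ≤ 1 := by
          rw [mul_div_assoc', div_le_one (by linarith)]; exact hKJ
        have h2 : 0 ≤ ε * q ^ (v.2 : ℕ) := by positivity
        nlinarith

variable {Ω : Type*} [MeasurableSpace Ω] {P : Measure Ω} [IsProbabilityMeasure P] {α ν : ℝ} {n : ℕ}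
  {V : Ω → Finset (ℝ × ℝ)}

lemma measureReal_cluster_le (hα : 1 < α) (hν : 0 < ν) (hn : 0 < n) (hR : 0 < radius ν n)
    (hV : IsPoi α ν n V P) {J J₁ : ℕ} {K : ℝ} (hK : 1 ≤ K)
    (hKJ : 16 * K * Real.exp (1 - α) ^ J₁ ≤ 1 - Real.exp (1 - α)) (s : Fin n × Fin J) (x : ℝ) :
    P.real {ω | 4 * x * Real.exp (1 / 2) ^ J ≤
      ∑ t ∈ cluster (siteAdj n J J₁ K (Real.exp (1 / 2))) (occupied (radius ν n) n J (V ω)) {s},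
        Real.exp (1 / 2) ^ (t.2 : ℕ)} ≤ 2 * Real.exp (-x) := by
  classical
  set q := Real.exp (1 / 2) with hqdef
  have hq : (1 : ℝ) ≤ q := Real.one_le_exp (by norm_num)
  have hq0 : 0 < q := by linarith
  set R := radius ν n with hRdef
  set X : Fin n × Fin J → Ω → ℕ := fun s ω => count (V ω) (cell R n s) with hX
  have hmeas : ∀ s : Fin n × Fin J, MeasurableSet (cell R n s) := fun s =>
    measurableSet_box hn _ _ _ _ _
  set ε : ℝ := 1 / (4 * q ^ J) with hε
  have hε0 : 0 < ε := by positivity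
  have hεq : ∀ s : Fin n × Fin J, ε * q ^ (s.2 : ℕ) ≤ 1 / 4 := fun s => by
    rw [hε, div_mul_eq_mul_div, one_mul, div_le_div_iff₀ (by positivity) (by norm_num)]
    have := pow_le_pow_right₀ hq s.2.2.le
    linarith
  set w : Fin n × Fin J → ℝ := fun s => ε * q ^ (s.2 : ℕ) with hw
  have hw0 : ∀ s, 0 ≤ w s := fun s => by positivity
  have hexp : ∀ s, Real.exp (2 * w s) - 1 ≤ 4 * w s := fun s => by
    have h1 : |2 * w s| ≤ 1 := by
      rw [abs_of_nonneg (by linarith [hw0 s])]; linarith [hεq s]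
    have := (le_abs_self _).trans (Real.abs_exp_sub_one_le h1)
    rw [abs_of_nonneg (by linarith [hw0 s])] at this
    linarith
  have hp : ∀ s, P.real {ω | X s ω ≠ 0} ≤ Real.exp (-(α * (s.2 : ℕ))) := fun s => by
    refine (hV.measureReal_count_ne_zero_le (hmeas s)).trans
      ((intensity_box_le (by linarith) hν hn hR (Nat.cast_nonneg _) (by linarith)).trans
        (le_of_eq ?_))
    ring
  have hmain := measure_cluster_le (P := P) (X := X)
    (fun s => hV.measurable_count _ (hmeas s))
    (hV.iIndepFun_count hmeas (disjoint_cell R n))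
    (A := siteAdj n J J₁ K q) (w := w) (g := fun s => 2 * w s) hw0
    (fun s => by linarith [hw0 s]) (fun v => by
      have := sum_siteAdj_le hα hK (p := fun s => P.real {ω | X s ω ≠ 0})
        (g := fun s => Real.exp (2 * w s) - 1) (fun _ => measureReal_nonneg) hp hε0.le hexp hKJ v
      have e : w v = ε * q ^ (v.2 : ℕ) := rfl
      linarith) {s} x
  have hset : {ω | 4 * x * q ^ J ≤ ∑ t ∈ cluster (siteAdj n J J₁ K q) (occupied R n J (V ω)) {s},
        q ^ (t.2 : ℕ)} ⊆ {ω | x ≤ ∑ u ∈ cluster (siteAdj n J J₁ K q)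
          (Finset.univ.filter fun v => X v ω ≠ 0) {s}, w u} := by
    intro ω hω
    simp only [Set.mem_ofPred_eq, hw] at hω ⊢
    rw [← Finset.mul_sum, hε, div_mul_eq_mul_div, one_mul, le_div_iff₀ (by positivity)]
    have hocc : occupied R n J (V ω) = Finset.univ.filter fun v => X v ω ≠ 0 := by
      ext; simp [hX, occupied]
    rw [hocc] at hω
    rw [show x * (4 * q ^ J) = 4 * x * q ^ J by ring]
    convert hω
  refine (measureReal_mono hset (measure_ne_top _ _)).trans (hmain.trans ?_)
  rw [Finset.prod_singleton, mul_comm]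
  refine mul_le_mul_of_nonneg_right ?_ (Real.exp_pos _).le
  have h1 : P.real {ω | X s ω ≠ 0} ≤ 1 := measureReal_le_one
  have h2 := hexp s
  have h3 := hεq s
  have h4 : 0 ≤ Real.exp (2 * w s) - 1 := sub_nonneg.2 (Real.one_le_exp (by linarith [hw0 s]))
  have e : w s = ε * q ^ (s.2 : ℕ) := rfl
  nlinarith

/-- The probability that the largest component is larger than expected. -/
theorem measureReal_largestComponentSize_gt_le (hα : 1 < α) (hν : 0 < ν) (hn : 0 < n)
    (hV : IsPoi α ν n V P) {J J₁ G L m : ℕ} (hG : 0 < G) (hL : 0 < L)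
    (hJ : (J : ℝ) + 1 ≤ radius ν n)
    (hGL : 2 * (connConst ν * Real.exp (1 / 2) ^ (2 * J₁)) * (G * L) ≤ n)
    {ξ : ℝ} (hξ0 : 0 ≤ ξ) (hξ : 2 * (n / G : ℝ) ≤ ξ * Real.exp (1 / 2) ^ (2 * J₁))
    (hKJ : 16 * (2 * connConst ν + ξ + 1) * Real.exp (1 - α) ^ J₁ ≤ 1 - Real.exp (1 - α))
    {x : ℝ} (hx : 1 ≤ x) :
    P.real {ω | m * ((2 * connConst ν * Real.exp (1 / 2) ^ J₁ + 2 * (2 * (n / G : ℝ)) + 4) *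
        (4 * x * Real.exp (1 / 2) ^ J)) <
        (largestComponentSize (graph (radius ν n) (V ω)) : ℝ)} ≤
      n * Real.exp (-(α * J)) + n * Real.exp (2 - m) +
        G * (1 - Real.exp (-(2 * connConst ν / (1 - Real.exp (1 - α))))) ^ L +
        n * J * (2 * Real.exp (-x)) := by
  classical
  set R := radius ν n with hRdef
  set q := Real.exp (1 / 2) with hqdef
  have hq : (1 : ℝ) ≤ q := Real.one_le_exp (by norm_num)
  have hc := connConst_pos hν
  have hR : 0 < R := by linarith [(Nat.cast_nonneg J : (0 : ℝ) ≤ J)]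
  set K := 2 * connConst ν + ξ + 1 with hK
  set E1 := {ω | count (V ω) (disk R)ᶜ ≠ 0} with hE1
  set E2 := {ω | count (V ω) (box R n J (R + 1) 0 n) ≠ 0} with hE2
  set E3 : ℕ → Set Ω := fun i => {ω | (m : ℝ) ≤ count (V ω) (box R n 0 (R + 1) (i : ℕ) ((i : ℕ) + 1))}
    with hE3
  set E4 : ℕ → Set Ω := fun g => {ω | ∀ l < L,
    count (V ω) (gapSet R n J₁ (connConst ν) (centre n G L g l)) ≠ 0} with hE4
  set E5 : Fin n × Fin J → Set Ω := fun s => {ω | 4 * x * q ^ J ≤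
    ∑ t ∈ cluster (siteAdj n J J₁ K q) (occupied R n J (V ω)) {s}, q ^ (t.2 : ℕ)} with hE5
  have hsub : {ω | m * ((2 * connConst ν * q ^ J₁ + 2 * (2 * (n / G : ℝ)) + 4) *
        (4 * x * q ^ J)) < (largestComponentSize (graph R (V ω)) : ℝ)} ⊆
      E1 ∪ (E2 ∪ ((⋃ i ∈ Finset.range n, E3 i) ∪ ((⋃ g ∈ Finset.range G, E4 g) ∪
        ⋃ s ∈ (Finset.univ : Finset (Fin n × Fin J)), E5 s))) := by
    intro ω hω
    by_contra hcon
    simp only [Set.mem_union, Set.mem_iUnion, Finset.mem_range, Finset.mem_univ, not_or,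
      not_exists, exists_prop] at hcon
    obtain ⟨h1, h2, h3, h4, h5⟩ := hcon
    refine absurd (largestComponentSize_le hν hn hG hL hJ hGL hξ (S := V ω) (m := m)
      (not_not.1 h1) (not_not.1 h2) (fun i hi => ?_) (fun g hg => ?_)
      (B := 4 * x * q ^ J) ?_ (fun s => ?_)) (not_le.2 hω)
    · have : ((count (V ω) (box R n 0 (R + 1) (i : ℕ) ((i : ℕ) + 1)) : ℕ) : ℝ) < m :=
        lt_of_not_ge fun h => h3 i ⟨hi, h⟩
      exact_mod_cast this.le
    · by_contra hno
      push Not at hno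
      exact h4 g ⟨hg, hno⟩
    · have := one_le_pow₀ hq (n := J)
      nlinarith
    · exact (lt_of_not_ge fun h => h5 s ⟨trivial, h⟩).le
  have hp1 : P.real E1 ≤ 0 := by
    refine (hV.measureReal_count_ne_zero_le (measurableSet_disk R).compl).trans ?_
    rw [intensity_compl_disk]; simp
  have hp2 : P.real E2 ≤ n * Real.exp (-(α * J)) := by
    refine (hV.measureReal_count_ne_zero_le (measurableSet_box hn _ _ _ _ _)).trans ?_
    refine (intensity_box_le (by linarith) hν hn hR (Nat.cast_nonneg _) (Nat.cast_nonneg n)).trans ?_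
    rw [sub_zero]
  have hp3 : ∀ i, P.real (E3 i) ≤ Real.exp (2 - m) := fun i => by
    refine hV.measureReal_ge_count_le (measurableSet_box hn _ _ _ _ _) ?_ _
    refine (intensity_box_le (by linarith) hν hn hR le_rfl (by linarith)).trans ?_
    simp
  have hp4 : ∀ g, P.real (E4 g) ≤ (1 - Real.exp (-(2 * connConst ν / (1 - Real.exp (1 - α))))) ^ L :=
    fun g => measureReal_forall_gapSet_le hα hν hn hR hV hG hL hc hGL g
  have hp5 : ∀ s, P.real (E5 s) ≤ 2 * Real.exp (-x) := fun s =>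
    measureReal_cluster_le hα hν hn hR hV (by linarith) hKJ s x
  have hu3 : P.real (⋃ i ∈ Finset.range n, E3 i) ≤ n * Real.exp (2 - m) := by
    refine (measureReal_biUnion_finset_le _ _).trans ((Finset.sum_le_sum fun i _ => hp3 i).trans ?_)
    simp
  have hu4 : P.real (⋃ g ∈ Finset.range G, E4 g) ≤
      G * (1 - Real.exp (-(2 * connConst ν / (1 - Real.exp (1 - α))))) ^ L := by
    refine (measureReal_biUnion_finset_le _ _).trans ((Finset.sum_le_sum fun i _ => hp4 i).trans ?_)
    simp
  have hu5 : P.real (⋃ s ∈ (Finset.univ : Finset (Fin n × Fin J)), E5 s) ≤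
      n * J * (2 * Real.exp (-x)) := by
    refine (measureReal_biUnion_finset_le _ _).trans ((Finset.sum_le_sum fun i _ => hp5 i).trans ?_)
    simp
  have b1 := measureReal_mono hsub (measure_ne_top P _)
  have b2 := measureReal_union_le (μ := P) E1 (E2 ∪ ((⋃ i ∈ Finset.range n, E3 i) ∪
    ((⋃ g ∈ Finset.range G, E4 g) ∪ ⋃ s ∈ (Finset.univ : Finset (Fin n × Fin J)), E5 s)))
  have b3 := measureReal_union_le (μ := P) E2 ((⋃ i ∈ Finset.range n, E3 i) ∪
    ((⋃ g ∈ Finset.range G, E4 g) ∪ ⋃ s ∈ (Finset.univ : Finset (Fin n × Fin J)), E5 s))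
  have b4 := measureReal_union_le (μ := P) (⋃ i ∈ Finset.range n, E3 i)
    ((⋃ g ∈ Finset.range G, E4 g) ∪ ⋃ s ∈ (Finset.univ : Finset (Fin n × Fin J)), E5 s)
  have b5 := measureReal_union_le (μ := P) (⋃ g ∈ Finset.range G, E4 g)
    (⋃ s ∈ (Finset.univ : Finset (Fin n × Fin J)), E5 s)
  linarith

end UpperProbability

/-! ### Asymptotics of the upper bound -/

section UpperAsymptotics

lemma eventually_const_le_mul {a : ℝ} (b : ℝ) (ha : 0 < a) : ∀ᶠ l : ℝ in atTop, b ≤ a * l :=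
  (tendsto_id.const_mul_atTop ha).eventually_ge_atTop b

lemma eventually_log_add_const_le (b : ℝ) : ∀ᶠ l : ℝ in atTop, Real.log l + b ≤ l := by
  have h := Real.isLittleO_log_id_atTop.def (by norm_num : (0 : ℝ) < 1 / 2)
  filter_upwards [h, eventually_const_le_mul b (by norm_num : (0 : ℝ) < 1 / 2),
    eventually_ge_atTop 0] with l h1 h2 h3
  rw [Real.norm_eq_abs, Real.norm_eq_abs, id, abs_of_nonneg h3] at h1
  linarith [le_abs_self (Real.log l)]

lemma eventually_const_mul_rpow_le_exp (b s : ℝ) {a : ℝ} (ha : 0 < a) :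
    ∀ᶠ l : ℝ in atTop, b * l ^ s ≤ Real.exp (a * l) := by
  have h := (isLittleO_rpow_exp_pos_mul_atTop s ha).def (by positivity : 0 < 1 / (|b| + 1))
  filter_upwards [h, eventually_ge_atTop 0] with l h1 h2
  have h3 : 0 ≤ l ^ s := Real.rpow_nonneg h2 s
  rw [Real.norm_eq_abs, Real.norm_eq_abs, abs_of_nonneg h3, abs_of_pos (Real.exp_pos _),
    div_mul_eq_mul_div, one_mul, le_div_iff₀ (by positivity)] at h1
  have := le_abs_self b
  nlinarith

/-- The exponent of the logarithm in the number of low layers. -/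
def lowExponent (α : ℝ) : ℝ := 2 / (α - 1)

set_option maxHeartbeats 1000000 in
theorem eventually_measureReal_gt_le {α ν : ℝ} (hα : 1 < α) (hν : 0 < ν) :
    ∀ᶠ l : ℝ in atTop, ∀ n : ℕ, 0 < n → Real.log n = l →
      ∀ {Ω : Type*} [MeasurableSpace Ω] (P : Measure Ω) [IsProbabilityMeasure P]
        (V : Ω → Finset (ℝ × ℝ)), IsPoi α ν n V P →
        P.real {ω | (n : ℝ) ^ (1 / (2 * α)) * l ^ (lowExponent α + 5) <
          (largestComponentSize (graph (radius ν n) (V ω)) : ℝ)} ≤ 1 / l + 16 * Real.exp (-l) := by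
  set c := connConst ν with hcdef
  have hc : 0 < c := connConst_pos hν
  set β := Real.exp (1 - α) with hβdef
  have hβ0 : 0 < β := Real.exp_pos _
  have hβ : β < 1 := Real.exp_lt_one_iff.2 (by linarith)
  set D := lowExponent α with hD
  have hD0 : 0 < D := div_pos two_pos (by linarith)
  set κ := 2 * c / (1 - β) with hκ
  have hκ0 : 0 < κ := div_pos (by positivity) (by linarith)
  set A := 2 * Real.exp κ with hA
  have hA2 : 2 ≤ A := by linarith [Real.one_le_exp hκ0.le]
  set e := Real.exp 1 with he
  have he0 : 0 < e := Real.exp_pos 1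
  set C' := 96 * (2 * c * e + 16 * c * e * (A + 1) + 4) with hC'
  filter_upwards [eventually_ge_atTop 1, eventually_log_add_const_le (4 + 2 * Real.log ν),
    eventually_const_le_mul (16 * (2 * c + 8 * c * (A + 1) + 1)) (by linarith : 0 < 1 - β),
    eventually_const_mul_rpow_le_exp (2 * c * e * (A + 1)) (D + 1) one_pos,
    eventually_const_le_mul 1 (by positivity : 0 < 4 * c), eventually_ge_atTop C']
    with l hl1 hlog hK hexp hGn hCl n hn hln Ω _ P _ V hV
  have hl0 : 0 < l := by linarith
  have hn' : (0 : ℝ) < n := by exact_mod_cast hn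
  have hnexp : (n : ℝ) = Real.exp l := by rw [← hln, Real.exp_log hn']
  have hlog0 : 0 ≤ Real.log l := Real.log_nonneg hl1
  have hlogl : Real.log l ≤ l := by linarith [Real.log_le_sub_one_of_pos hl0]
  have hlexp : l ≤ Real.exp l := by linarith [Real.add_one_le_exp l]
  set J := ⌈(l + Real.log l) / α⌉₊ with hJdef
  set J₁ := ⌈D * Real.log l⌉₊ with hJ₁def
  set L := ⌈A * l⌉₊ with hLdef
  set m := ⌈3 * l⌉₊ with hmdef
  have hJ1 : (l + Real.log l) / α ≤ J := Nat.le_ceil _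
  have hJ2 : (J : ℝ) < (l + Real.log l) / α + 1 := Nat.ceil_lt_add_one (by positivity)
  have hJ₁1 : D * Real.log l ≤ J₁ := Nat.le_ceil _
  have hJ₁2 : (J₁ : ℝ) < D * Real.log l + 1 := Nat.ceil_lt_add_one (by positivity)
  have hL1 : A * l ≤ L := Nat.le_ceil _
  have hL2 : (L : ℝ) < A * l + 1 := Nat.ceil_lt_add_one (by positivity)
  have hm1 : 3 * l ≤ m := Nat.le_ceil _
  have hm2 : (m : ℝ) < 3 * l + 1 := Nat.ceil_lt_add_one (by positivity)
  have hL3 : (L : ℝ) ≤ (A + 1) * l := by linarith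
  have hL0 : 0 < L := by
    have : (0 : ℝ) < L := lt_of_lt_of_le (by positivity) hL1
    exact_mod_cast this
  have hL0' : (0 : ℝ) < L := by exact_mod_cast hL0
  set q := Real.exp (1 / 2) with hqdef
  have hlD : 1 ≤ l ^ D := Real.one_le_rpow hl1 hD0.le
  have hqJ₁ : q ^ (2 * J₁) ≤ e * l ^ D := by
    rw [hqdef, exp_half_pow_two_mul, ← Real.exp_nat_mul, he, Real.rpow_def_of_pos hl0,
      ← Real.exp_add]
    exact Real.exp_le_exp.2 (by linarith)
  have hqJ₁' : 1 ≤ q ^ (2 * J₁) := one_le_pow₀ (Real.one_le_exp (by norm_num))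
  have hqJ₁'' : q ^ J₁ ≤ e * l ^ D :=
    (pow_le_pow_right₀ (Real.one_le_exp (by norm_num)) (by omega)).trans hqJ₁
  set u := 2 * (c * q ^ (2 * J₁)) * L with hu
  have hu0 : 0 < u := by positivity
  have hun : u ≤ n := by
    have h1 : u ≤ 2 * (c * (e * l ^ D)) * ((A + 1) * l) := by
      rw [hu]; gcongr
    have h2 : l ^ (D + 1) = l ^ D * l := by rw [Real.rpow_add hl0, Real.rpow_one]
    rw [hnexp, ← one_mul l]
    refine h1.trans (le_trans (le_of_eq ?_) hexp)
    rw [h2]; ring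
  set G := ⌊(n : ℝ) / u⌋₊ with hGdef
  have hy1 : 1 ≤ (n : ℝ) / u := by rwa [one_le_div hu0]
  have hG1 : (G : ℝ) ≤ n / u := Nat.floor_le (by positivity)
  have hG2 : (n : ℝ) / u < G + 1 := Nat.lt_floor_add_one _
  have hG0 : 0 < G := Nat.floor_pos.2 hy1
  have hG0' : (1 : ℝ) ≤ G := by exact_mod_cast hG0
  have hGL : 2 * (c * q ^ (2 * J₁)) * (G * L) ≤ n := by
    rw [le_div_iff₀ hu0] at hG1
    calc _ = G * u := by rw [hu]; ring
      _ ≤ n := hG1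
  have hnG : (n : ℝ) / G ≤ 2 * u := by
    rw [div_le_iff₀ (by linarith)]
    rw [div_lt_iff₀ hu0] at hG2
    have := mul_le_mul_of_nonneg_right hG0' hu0.le
    linarith
  have hGn' : (G : ℝ) ≤ n := by
    refine hG1.trans (div_le_self hn'.le ?_)
    have h1 : 2 * (c * 1) * (2 * l) ≤ u := by
      rw [hu]
      have : 2 * l ≤ L := (mul_le_mul_of_nonneg_right hA2 hl0.le).trans hL1
      gcongr
    linarith
  have hξ : 2 * (n / G : ℝ) ≤ (8 * c * L) * q ^ (2 * J₁) := by
    rw [hu] at hnG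
    linarith
  have hKJ : 16 * (2 * c + 8 * c * L + 1) * β ^ J₁ ≤ 1 - β := by
    have h1 : β ^ J₁ ≤ 1 / l ^ 2 := by
      rw [hβdef, ← Real.exp_nat_mul, one_div, ← Real.exp_log (by positivity : 0 < l ^ 2),
        ← Real.exp_neg, Real.log_pow]
      refine Real.exp_le_exp.2 ?_
      have h2 : D * (α - 1) = 2 := by
        rw [hD, lowExponent, div_mul_cancel₀ _ (by linarith)]
      have h3 := mul_le_mul_of_nonneg_right hJ₁1 (by linarith : 0 ≤ α - 1)
      rw [mul_right_comm, h2] at h3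
      push_cast
      linarith
    have h2 : 16 * (2 * c + 8 * c * L + 1) ≤ (1 - β) * l ^ 2 := by
      have : 16 * (2 * c + 8 * c * L + 1) ≤ 16 * (2 * c + 8 * c * (A + 1) + 1) * l := by
        have h3 := mul_le_mul_of_nonneg_left hL3 hc.le
        have h4 := mul_le_mul_of_nonneg_left hl1 hc.le
        linarith
      have h3 := mul_le_mul_of_nonneg_right hK hl0.le
      linarith
    calc _ ≤ (1 - β) * l ^ 2 * (1 / l ^ 2) := by
          refine mul_le_mul h2 h1 (by positivity) ?_
          have : 0 ≤ 1 - β := by linarith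
          positivity
      _ = 1 - β := by field_simp
  have hJα : (l + Real.log l) / α ≤ l + Real.log l := div_le_self (by linarith) hα.le
  have hJR : (J : ℝ) + 1 ≤ radius ν n := by
    rw [radius, Real.log_div hn'.ne' hν.ne', hln]
    linarith
  have hmain := measureReal_largestComponentSize_gt_le hα hν hn hV hG0 hL0 hJR hGL (m := m)
    (by positivity) hξ hKJ (x := 3 * l) (by linarith)
  refine le_trans (measureReal_mono ?_ (measure_ne_top _ _)) (hmain.trans ?_)
  · intro ω hω
    rw [Set.mem_ofPred_eq] at hω ⊢
    refine lt_of_le_of_lt ?_ hω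
    have hqJ : q ^ J ≤ 2 * ((n : ℝ) ^ (1 / (2 * α)) * l) := by
      have h1 : q ^ J ≤ Real.exp (1 / 2) * ((n : ℝ) ^ (1 / (2 * α)) * Real.exp (Real.log l)) := by
        rw [hqdef, ← Real.exp_nat_mul, Real.rpow_def_of_pos hn', hln, ← Real.exp_add,
          ← Real.exp_add]
        refine Real.exp_le_exp.2 ?_
        have h2 : (l + Real.log l) / α ≤ l / α + Real.log l := by
          rw [add_div]
          gcongr
          exact div_le_self hlog0 hα.le
        have h3 : l * (1 / (2 * α)) = (l / α) / 2 := by field_simp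
        linarith
      rw [Real.exp_log hl0] at h1
      have h2 : Real.exp (1 / 2) ≤ 2 := by
        have h3 : Real.exp (1 / 2) ^ 2 = Real.exp 1 := by
          rw [← Real.exp_nat_mul]; norm_num
        have := Real.exp_one_lt_d9
        nlinarith [Real.exp_pos (1 / 2)]
      have h4 : 0 ≤ (n : ℝ) ^ (1 / (2 * α)) * l := by positivity
      exact h1.trans (mul_le_mul_of_nonneg_right h2 h4)
    set N := (n : ℝ) ^ (1 / (2 * α)) with hN
    have hN0 : 0 < N := by positivity
    have hmid : 2 * c * q ^ J₁ + 2 * (2 * (n / G : ℝ)) + 4 ≤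
        (2 * c * e + 16 * c * e * (A + 1) + 4) * (l ^ D * l) := by
      have h1 : 2 * c * q ^ J₁ ≤ 2 * c * e * (l ^ D * l) := by
        have : e * l ^ D ≤ e * (l ^ D * l) := by
          have := mul_le_mul_of_nonneg_left hl1 (by positivity : 0 ≤ e * l ^ D)
          linarith
        have := mul_le_mul_of_nonneg_left (hqJ₁''.trans this) (by positivity : 0 ≤ 2 * c)
        linarith
      have h2 : 2 * (2 * (n / G : ℝ)) ≤ 16 * c * e * (A + 1) * (l ^ D * l) := by
        have h3 : (8 * c * L) * q ^ (2 * J₁) ≤ (8 * c * ((A + 1) * l)) * (e * l ^ D) := by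
          gcongr
        linarith
      have h3 : 4 ≤ 4 * (l ^ D * l) := by linarith [one_le_mul_of_one_le_of_one_le hlD hl1]
      linarith
    have hm3 : (m : ℝ) ≤ 4 * l := by linarith
    have hpow : l ^ (D + 5) = l ^ D * l * l * l * l * l := by
      rw [Real.rpow_add hl0, show (5 : ℝ) = (5 : ℕ) by norm_num, Real.rpow_natCast]
      ring
    calc (m : ℝ) * ((2 * c * q ^ J₁ + 2 * (2 * (n / G : ℝ)) + 4) * (4 * (3 * l) * q ^ J))
        ≤ (4 * l) * (((2 * c * e + 16 * c * e * (A + 1) + 4) * (l ^ D * l)) *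
          (4 * (3 * l) * (2 * (N * l)))) := by
          gcongr
      _ = C' * (N * (l ^ D * l * l * l * l)) := by rw [hC']; ring
      _ ≤ l * (N * (l ^ D * l * l * l * l)) := by gcongr
      _ = N * l ^ (D + 5) := by rw [hpow]; ring
  · have t1 : n * Real.exp (-(α * J)) ≤ 1 / l := by
      have h1 : l + Real.log l ≤ α * J := by
        rw [div_le_iff₀ (by linarith)] at hJ1; linarith
      rw [hnexp, ← Real.exp_add, one_div]
      nth_rewrite 2 [← Real.exp_log hl0]
      rw [← Real.exp_neg]
      exact Real.exp_le_exp.2 (by linarith)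
    have t2 : n * Real.exp (2 - m) ≤ 9 * Real.exp (-l) := by
      have h1 : Real.exp 2 ≤ 9 := by
        have : Real.exp 2 = e * e := by rw [he, ← Real.exp_add]; norm_num
        have := Real.exp_one_lt_d9
        nlinarith
      have h2 : n * Real.exp (2 - m) ≤ Real.exp 2 * Real.exp (-l) := by
        rw [hnexp, ← Real.exp_add, ← Real.exp_add]
        exact Real.exp_le_exp.2 (by linarith)
      exact h2.trans (mul_le_mul_of_nonneg_right h1 (Real.exp_pos _).le)
    have t3 : G * (1 - Real.exp (-κ)) ^ L ≤ Real.exp (-l) := by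
      have h1 : (1 - Real.exp (-κ)) ^ L ≤ Real.exp (-(2 * l)) := by
        have h2 : 1 - Real.exp (-κ) ≤ Real.exp (-Real.exp (-κ)) := by
          linarith [Real.add_one_le_exp (-Real.exp (-κ))]
        have h3 : 0 ≤ 1 - Real.exp (-κ) := by
          have := Real.exp_lt_one_iff.2 (by linarith : -κ < 0); linarith
        refine (pow_le_pow_left₀ h3 h2 L).trans ?_
        rw [← Real.exp_nat_mul]
        refine Real.exp_le_exp.2 ?_
        have h4 : A * l * Real.exp (-κ) = 2 * l := by
          rw [hA, Real.exp_neg]; field_simp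
        have h5 := mul_le_mul_of_nonneg_right hL1 (Real.exp_pos (-κ)).le
        linarith
      calc _ ≤ n * Real.exp (-(2 * l)) := by
            refine mul_le_mul hGn' h1 (pow_nonneg ?_ _) hn'.le
            have := Real.exp_lt_one_iff.2 (by linarith : -κ < 0); linarith
        _ = Real.exp (-l) := by rw [hnexp, ← Real.exp_add]; congr 1; ring
    have t4 : n * J * (2 * Real.exp (-(3 * l))) ≤ 6 * Real.exp (-l) := by
      have h1 : (J : ℝ) ≤ 3 * n := by rw [hnexp]; linarith
      calc _ ≤ n * (3 * n) * (2 * Real.exp (-(3 * l))) := by gcongr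
        _ = 6 * Real.exp (-l) := by
          have : Real.exp (-l) = Real.exp l * Real.exp l * Real.exp (-(3 * l)) := by
            rw [← Real.exp_add, ← Real.exp_add]; congr 1; ring
          rw [hnexp, this]; ring
    linarith

end UpperAsymptotics

/-! ### The lower bound -/

section Lower

/-- The points of a sector close to the boundary of the disk are all joined to a point of the
sector which is sufficiently far from the boundary. -/
lemma count_box_le_largestComponentSize {R t : ℝ} {n M : ℕ} (hn : 0 < n) (hM : 0 < M) (ht : 0 ≤ t)
    (htR : t + 2 ≤ R) (hMR : 2 * Real.pi * Real.exp ((R - t) / 2) ≤ M) {S : Finset (ℝ × ℝ)}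
    (i : ℕ) {p : ℝ × ℝ} (hp : p ∈ S) (hp1 : t ≤ R - p.1) (hp2 : R - p.1 < t + 1)
    (hp3 : i * (n / M : ℝ) ≤ pos n p) (hp4 : pos n p < (i + 1) * (n / M : ℝ)) :
    count S (box R n 0 (0 + 1) (i * (n / M : ℝ)) ((i + 1) * (n / M : ℝ))) ≤
      largestComponentSize (graph R S) := by
  classical
  have hn' : (0 : ℝ) < n := by exact_mod_cast hn
  have hM' : (0 : ℝ) < M := by exact_mod_cast hM
  have hpi := Real.pi_pos
  set C := (graph R S).connectedComponentMk ⟨p, hp⟩ with hC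
  have hbdd : BddAbove (Set.range fun c : (graph R S).ConnectedComponent => c.supp.ncard) :=
    (Set.finite_range _).bddAbove
  refine le_trans ?_ (le_ciSup hbdd C)
  rw [count, ← Set.ncard_image_of_injective C.supp Subtype.val_injective]
  refine Set.ncard_le_ncard ?_ (Set.toFinite _)
  rintro v ⟨hvS, ⟨hv1, hv2⟩, hv3, hv4⟩
  refine ⟨⟨v, hvS⟩, ?_, rfl⟩
  rw [SimpleGraph.ConnectedComponent.mem_supp_iff, hC, SimpleGraph.ConnectedComponent.eq]
  by_cases hvp : v = p
  · subst hvp; rfl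
  refine SimpleGraph.Adj.reachable ⟨fun h => hvp (congrArg Subtype.val h), ?_⟩
  refine hypDist_le_of_sq_le (by linarith) (by simp only; linarith) (by simp only; linarith)
    (by simp only; linarith) (by simp only; linarith) ?_
  simp only
  have h1 : |v.2 - p.2| ≤ Real.exp (-((R - t) / 2)) := by
    have h2 : |pos n v - pos n p| ≤ n / M := by
      rw [abs_le]; constructor <;> linarith
    have h3 : pos n v - pos n p = (v.2 - p.2) * (n / (2 * Real.pi)) := by
      rw [pos, pos]; ring
    rw [h3, abs_mul, abs_of_pos (by positivity : 0 < (n : ℝ) / (2 * Real.pi)),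
      mul_div_assoc', div_le_div_iff₀ (by positivity) hM'] at h2
    have h4 : |v.2 - p.2| * M ≤ 2 * Real.pi := by
      have : n * (|v.2 - p.2| * M) ≤ n * (2 * Real.pi) := by linarith
      exact le_of_mul_le_mul_left this hn'
    have h5 : |v.2 - p.2| * (2 * Real.pi * Real.exp ((R - t) / 2)) ≤ 2 * Real.pi :=
      (mul_le_mul_of_nonneg_left hMR (abs_nonneg _)).trans h4
    rw [Real.exp_neg, ← one_div, le_div_iff₀ (Real.exp_pos _)]
    have : 2 * Real.pi * (|v.2 - p.2| * Real.exp ((R - t) / 2)) ≤ 2 * Real.pi * 1 := by linarith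
    exact le_of_mul_le_mul_left this (by positivity)
  rw [← sq_abs]
  refine (pow_le_pow_left₀ (abs_nonneg _) h1 2).trans ?_
  rw [← Real.exp_nat_mul]
  refine Real.exp_le_exp.2 ?_
  push_cast
  linarith

lemma measureReal_largestComponentSize_lt_le {Ω : Type*} [MeasurableSpace Ω] {P : Measure Ω}
    [IsProbabilityMeasure P] {α ν : ℝ} {n : ℕ} {V : Ω → Finset (ℝ × ℝ)} (hα : 1 < α) (hν : 0 < ν)
    (hn : 0 < n) (hV : IsPoi α ν n V P) {t : ℝ} {M : ℕ} (hM : 0 < M) (ht : 0 ≤ t)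
    (htR : t + 2 ≤ radius ν n) (hMR : 2 * Real.pi * Real.exp ((radius ν n - t) / 2) ≤ M) :
    P.real {ω | (largestComponentSize (graph (radius ν n) (V ω)) : ℝ) <
        n / M * (Real.exp (-α) / 4) / 2} ≤
      Real.exp (-(n * (Real.exp (-(α * (t + 1))) / 4))) +
        M * Real.exp (-(n / M * (Real.exp (-α) / 4) / 10)) := by
  set R := radius ν n with hR
  have hn' : (0 : ℝ) < n := by exact_mod_cast hn
  have hM' : (0 : ℝ) < M := by exact_mod_cast hM
  set E0 := {ω | count (V ω) (box R n t (t + 1) 0 n) = 0} with hE0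
  set B : ℕ → Set (ℝ × ℝ) := fun i => box R n 0 (0 + 1) (i * (n / M : ℝ)) ((i + 1) * (n / M : ℝ))
    with hB
  set lam := n / M * (Real.exp (-α) / 4) with hlam
  have hlamB : ∀ i < M, lam ≤ (intensity α ν n (B i)).toReal := fun i hi => by
    have hi' : (i : ℝ) + 1 ≤ M := by exact_mod_cast hi
    refine le_trans (le_of_eq ?_) (le_intensity_box hα.le hν hn le_rfl (by linarith)
      (by positivity) ?_)
    · rw [hlam, zero_add, mul_one]; ring
    · calc ((i : ℝ) + 1) * (n / M) ≤ M * (n / M) := by gcongr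
        _ = n := by field_simp
  set E1 : ℕ → Set Ω := fun i => {ω | (count (V ω) (B i) : ℝ) ≤
    (intensity α ν n (B i)).toReal / 2} with hE1
  have hsub : {ω | (largestComponentSize (graph R (V ω)) : ℝ) < lam / 2} ⊆
      E0 ∪ ⋃ i ∈ Finset.range M, E1 i := by
    intro ω hω
    by_contra hcon
    simp only [Set.mem_union, Set.mem_iUnion, Finset.mem_range, not_or, not_exists,
      exists_prop] at hcon
    obtain ⟨h0, h1⟩ := hcon
    obtain ⟨p, hpS, hpB⟩ : ((V ω : Set (ℝ × ℝ)) ∩ box R n t (t + 1) 0 n).Nonempty :=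
      Set.nonempty_of_ncard_ne_zero h0
    set i := ⌊pos n p / (n / M)⌋₊ with hi
    have hp0 : 0 ≤ pos n p / (n / M) := div_nonneg hpB.2.1 (by positivity)
    have hi1 := Nat.floor_le hp0
    have hi2 := Nat.lt_floor_add_one (pos n p / (n / M))
    rw [le_div_iff₀ (by positivity)] at hi1
    rw [div_lt_iff₀ (by positivity)] at hi2
    have hiM : i < M := by
      rw [Nat.floor_lt hp0, div_lt_iff₀ (by positivity)]
      calc pos n p < n := hpB.2.2
        _ = M * (n / M) := by field_simp
    have h2 := count_box_le_largestComponentSize hn hM ht htR hMR i hpS hpB.1.1 hpB.1.2 hi1 hi2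
    have h3 : (intensity α ν n (B i)).toReal / 2 < (count (V ω) (B i) : ℝ) :=
      lt_of_not_ge fun h => h1 i ⟨hiM, h⟩
    have h4 := hlamB i hiM
    have h5 : (count (V ω) (B i) : ℝ) ≤ largestComponentSize (graph R (V ω)) :=
      Nat.cast_le.2 h2
    have h6 : (largestComponentSize (graph R (V ω)) : ℝ) < lam / 2 := hω
    linarith
  have hp0 : P.real E0 ≤ Real.exp (-(n * (Real.exp (-(α * (t + 1))) / 4))) := by
    rw [hE0, hV.measureReal_count_eq_zero (measurableSet_box hn _ _ _ _ _)]
    refine Real.exp_le_exp.2 (neg_le_neg ?_)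
    have := le_intensity_box hα.le hν hn ht (by linarith) le_rfl le_rfl
    rwa [sub_zero] at this
  have hp1 : ∀ i < M, P.real (E1 i) ≤ Real.exp (-(lam / 10)) := fun i hi =>
    (hV.measureReal_count_le_half (measurableSet_box hn _ _ _ _ _)).trans
      (Real.exp_le_exp.2 (neg_le_neg (div_le_div_of_nonneg_right (hlamB i hi) (by norm_num))))
  refine (measureReal_mono hsub (measure_ne_top _ _)).trans ((measureReal_union_le _ _).trans
    (add_le_add hp0 ((measureReal_biUnion_finset_le _ _).trans
      ((Finset.sum_le_sum fun i hi => hp1 i (Finset.mem_range.1 hi)).trans ?_))))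
  simp

theorem eventually_measureReal_lt_le {α ν : ℝ} (hα : 1 < α) (hν : 0 < ν) :
    ∀ᶠ l : ℝ in atTop, ∀ n : ℕ, 0 < n → Real.log n = l →
      ∀ {Ω : Type*} [MeasurableSpace Ω] (P : Measure Ω) [IsProbabilityMeasure P]
        (V : Ω → Finset (ℝ × ℝ)), IsPoi α ν n V P →
        P.real {ω | (largestComponentSize (graph (radius ν n) (V ω)) : ℝ) <
          (n : ℝ) ^ (1 / (2 * α)) * l ^ (-2 : ℝ)} ≤
          Real.exp (-(Real.exp (-α) / 4 * l)) + 8 / ν * Real.exp (-l) := by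
  set a := Real.exp (-α) with ha
  have ha0 : 0 < a := Real.exp_pos _
  have hα2 : 0 < 1 / (2 * α) := by positivity
  filter_upwards [eventually_ge_atTop 1, eventually_log_add_const_le (2 + 2 * Real.log ν),
    eventually_log_add_const_le 0,
    eventually_const_le_mul 64 (by positivity : 0 < ν * a),
    eventually_const_mul_rpow_le_exp (640 / (ν * a)) 2 hα2]
    with l hl1 hlog hlog' hfin hbig n hn hln Ω _ P _ V hV
  have hl0 : 0 < l := by linarith
  have hn' : (0 : ℝ) < n := by exact_mod_cast hn
  have hnexp : (n : ℝ) = Real.exp l := by rw [← hln, Real.exp_log hn']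
  have hlog0 : 0 ≤ Real.log l := Real.log_nonneg hl1
  have hpi := Real.pi_pos
  set t := (l - Real.log l) / α with ht
  have ht0 : 0 ≤ t := div_nonneg (by linarith) (by linarith)
  have htl : t ≤ l := (div_le_self (by linarith) hα.le).trans (by linarith)
  have htR : t + 2 ≤ radius ν n := by
    rw [radius, Real.log_div hn'.ne' hν.ne', hln]
    have : t ≤ l - Real.log l := div_le_self (by linarith) hα.le
    linarith
  set R := radius ν n with hR
  set M := ⌈2 * Real.pi * Real.exp ((R - t) / 2)⌉₊ with hMdef
  have hM1 : 2 * Real.pi * Real.exp ((R - t) / 2) ≤ M := Nat.le_ceil _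
  have hM0' : (0 : ℝ) < M := lt_of_lt_of_le (by positivity) hM1
  have hM0 : 0 < M := by exact_mod_cast hM0'
  have hone : 1 ≤ Real.exp ((R - t) / 2) := Real.one_le_exp (by linarith)
  have hM2 : (M : ℝ) ≤ 8 * Real.exp ((R - t) / 2) := by
    have h1 : (M : ℝ) < 2 * Real.pi * Real.exp ((R - t) / 2) + 1 :=
      Nat.ceil_lt_add_one (by positivity)
    have := Real.pi_lt_d2
    nlinarith
  have hexpR : Real.exp ((R - t) / 2) * Real.exp (t / 2) = n / ν := by
    rw [← Real.exp_add, ← exp_radius_half hν hn]; congr 1; ring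
  have hM3 : (M : ℝ) ≤ 8 / ν * n := by
    have h1 : 1 ≤ Real.exp (t / 2) := Real.one_le_exp (by linarith)
    have h2 : Real.exp ((R - t) / 2) ≤ n / ν := by rw [← hexpR]; nlinarith
    calc (M : ℝ) ≤ 8 * (n / ν) := hM2.trans (by linarith)
      _ = _ := by ring
  set N := (n : ℝ) ^ (1 / (2 * α)) with hN
  have hN0 : 0 < N := by positivity
  have hNexp : N = Real.exp (1 / (2 * α) * l) := by
    rw [hN, Real.rpow_def_of_pos hn', hln, mul_comm]
  have hexpt : N / l ≤ Real.exp (t / 2) := by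
    rw [hNexp]
    nth_rewrite 2 [← Real.exp_log hl0]
    rw [← Real.exp_sub]
    refine Real.exp_le_exp.2 ?_
    have h1 : Real.log l / α ≤ Real.log l := div_le_self hlog0 hα.le
    have h2 : 1 / (2 * α) * l = l / α / 2 := by field_simp
    rw [h2, ht, sub_div]
    linarith
  have hlam : ν * a / 32 * (N / l) ≤ n / M * (a / 4) := by
    have h1 : ν / 8 * Real.exp (t / 2) ≤ n / M := by
      rw [le_div_iff₀ hM0']
      calc _ ≤ ν / 8 * Real.exp (t / 2) * (8 * Real.exp ((R - t) / 2)) := by gcongr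
        _ = ν * (Real.exp ((R - t) / 2) * Real.exp (t / 2)) := by ring
        _ = n := by rw [hexpR]; field_simp
    calc _ ≤ ν * a / 32 * Real.exp (t / 2) := by gcongr
      _ = ν / 8 * Real.exp (t / 2) * (a / 4) := by ring
      _ ≤ _ := by gcongr
  have hl2 : l ^ (2 : ℝ) = l * l := by
    rw [show (2 : ℝ) = (2 : ℕ) by norm_num, Real.rpow_natCast, pow_two]
  have hmain := measureReal_largestComponentSize_lt_le hα hν hn hV hM0 ht0 htR hM1
  refine le_trans (measureReal_mono ?_ (measure_ne_top _ _)) (hmain.trans (add_le_add ?_ ?_))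
  · intro ω hω
    rw [Set.mem_ofPred_eq] at hω ⊢
    refine hω.trans_le ?_
    have h1 : N * l ^ (-2 : ℝ) ≤ ν * a / 32 * (N / l) / 2 := by
      rw [Real.rpow_neg hl0.le, hl2]
      have h2 : N * (l * l)⁻¹ = N / l * (1 / l) := by field_simp
      have h3 : 1 / l ≤ ν * a / 64 := by
        rw [div_le_iff₀ hl0]; linarith
      have h4 : 0 < N / l := by positivity
      rw [h2]
      nlinarith
    linarith
  · refine Real.exp_le_exp.2 (neg_le_neg (le_of_eq ?_))
    have h1 : α * (t + 1) = l - Real.log l + α := by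
      rw [ht, mul_add, mul_div_cancel₀ _ (by linarith)]; ring
    have h2 : n * Real.exp (-(α * (t + 1))) = a * l := by
      have h3 : a * l = Real.exp (-α + Real.log l) := by rw [Real.exp_add, Real.exp_log hl0]
      rw [h1, hnexp, h3, ← Real.exp_add]
      congr 1; ring
    linarith
  · have h1 : 2 * l ≤ n / M * (a / 4) / 10 := by
      have h2 : 640 / (ν * a) * (l * l) ≤ N := by rw [hNexp, ← hl2]; exact hbig
      rw [div_mul_eq_mul_div, div_le_iff₀ (by positivity)] at h2
      have h3 : 20 * l ≤ ν * a / 32 * (N / l) := by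
        rw [mul_div_assoc', le_div_iff₀ hl0]
        linarith
      linarith
    calc _ ≤ 8 / ν * n * Real.exp (-(2 * l)) := by gcongr
      _ = 8 / ν * Real.exp (-l) := by
        rw [mul_assoc, hnexp, ← Real.exp_add]
        congr 2; ring

end Lower

end HypGraph

end

theorem theorem1 (α ν : ℝ) (hα : 1 < α) (hν : 0 < ν) :
    ∃ C : ℝ, 0 < C ∧
      ∀ (Ω : ℕ → Type*) [∀ n, MeasurableSpace (Ω n)]
        (P : ∀ n, Measure (Ω n)) [∀ n, IsProbabilityMeasure (P n)]
        (V : ∀ n, Ω n → Finset (ℝ × ℝ)),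
        (∀ n, HypGraph.IsPoi α ν n (V n) (P n)) →
        Tendsto
          (fun n : ℕ => P n {ω |
            (n : ℝ) ^ (1 / (2 * α)) * Real.log n ^ (-C) ≤
              (HypGraph.largestComponentSize
                (HypGraph.graph (HypGraph.radius ν n) (V n ω)) : ℝ) ∧
            (HypGraph.largestComponentSize
                (HypGraph.graph (HypGraph.radius ν n) (V n ω)) : ℝ) ≤
              (n : ℝ) ^ (1 / (2 * α)) * Real.log n ^ C})
          atTop (𝓝 1) := by
  have hD : 0 < HypGraph.lowExponent α := div_pos two_pos (by linarith)
  refine ⟨HypGraph.lowExponent α + 5, by linarith, ?_⟩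
  intro Ω _ P _ V hV
  set C := HypGraph.lowExponent α + 5 with hC
  set δ : ℝ → ℝ := fun l => (Real.exp (-(Real.exp (-α) / 4 * l)) + 8 / ν * Real.exp (-l)) +
    (1 / l + 16 * Real.exp (-l)) with hδ
  have hδ0 : Tendsto δ atTop (𝓝 0) := by
    have h1 : Tendsto (fun l : ℝ => Real.exp (-l)) atTop (𝓝 0) := Real.tendsto_exp_neg_atTop_nhds_zero
    have h2 : Tendsto (fun l : ℝ => Real.exp (-(Real.exp (-α) / 4 * l))) atTop (𝓝 0) :=
      h1.comp (tendsto_id.const_mul_atTop (by positivity))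
    have h3 : Tendsto (fun l : ℝ => 1 / l) atTop (𝓝 0) := by
      simpa using tendsto_inv_atTop_zero (𝕜 := ℝ)
    simpa [hδ] using (h2.add (h1.const_mul (8 / ν))).add (h3.add (h1.const_mul 16))
  have hlog : Tendsto (fun n : ℕ => Real.log n) atTop atTop :=
    Real.tendsto_log_atTop.comp tendsto_natCast_atTop_atTop
  set E : ∀ n, Set (Ω n) := fun n => {ω |
    (n : ℝ) ^ (1 / (2 * α)) * Real.log n ^ (-C) ≤
      (HypGraph.largestComponentSize (HypGraph.graph (HypGraph.radius ν n) (V n ω)) : ℝ) ∧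
    (HypGraph.largestComponentSize (HypGraph.graph (HypGraph.radius ν n) (V n ω)) : ℝ) ≤
      (n : ℝ) ^ (1 / (2 * α)) * Real.log n ^ C} with hE
  have hcompl : ∀ᶠ n : ℕ in atTop, (P n).real (E n)ᶜ ≤ δ (Real.log n) := by
    filter_upwards [hlog.eventually (HypGraph.eventually_measureReal_gt_le hα hν),
      hlog.eventually (HypGraph.eventually_measureReal_lt_le hα hν), eventually_gt_atTop 0,
      hlog.eventually (eventually_ge_atTop 1)] with n h1 h2 hn hl
    have b1 := h1 n hn rfl (P n) (V n) (hV n)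
    have b2 := h2 n hn rfl (P n) (V n) (hV n)
    refine le_trans (measureReal_mono (fun ω hω => ?_) (measure_ne_top _ _))
      ((measureReal_union_le _ _).trans (add_le_add b2 b1))
    by_contra hcon
    simp only [Set.mem_union, not_or, Set.mem_ofPred_eq, not_lt] at hcon
    refine hω ⟨le_trans ?_ hcon.1, hcon.2⟩
    have : Real.log n ^ (-C) ≤ Real.log n ^ (-2 : ℝ) :=
      Real.rpow_le_rpow_of_exponent_le hl (by linarith)
    gcongr
  have hlow : ∀ᶠ n : ℕ in atTop, ENNReal.ofReal (1 - δ (Real.log n)) ≤ P n (E n) := by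
    filter_upwards [hcompl] with n hn
    have h1 : (1 : ℝ) ≤ (P n).real (E n) + (P n).real (E n)ᶜ := by
      have := measureReal_union_le (μ := P n) (E n) (E n)ᶜ
      rwa [Set.union_compl_self, probReal_univ] at this
    refine ENNReal.ofReal_le_of_le_toReal ?_
    have h2 : (P n).real (E n) = (P n (E n)).toReal := rfl
    linarith
  refine tendsto_of_tendsto_of_tendsto_of_le_of_le' ?_ tendsto_const_nhds hlow
    (Eventually.of_forall fun n => prob_le_one)
  have := ENNReal.tendsto_ofReal ((hδ0.comp hlog).const_sub 1)
  simpa using this
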